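/- **Model.** A dual graph network consists of two undirected graphs $G=(V,E)$, $G'=(V,E')$ with $E\subseteq E'$ and $|V|=n\ge 1$. A distributed algorithm is a collection of $n$ randomized processes, assigned to the nodes by an arbitrary bijection unknown to them. In each synchronous round $1,2,\dots$ every process gets at most one input $bcast(m)$ and then decides, at random, whether and what to transmit. Next an adversary that knows the whole history and these decisions chooses a reach set between $E$ and $E'$. A node that transmits receives its own packet; any other node receives a packet iff exactly one of its neighbors in the reach set transmits. Finally the processes generate outputs $ack(m)$, $rcv(m)$. The inputs are chosen by an environment that also knows the history; it never inputs the same message twice, and gives an input to a process only if this is its first input or if the last of its $bcast$ and $ack$ actions is an $ack$. Process $u$ is *active with $m$* in round $r$ if it received $bcast(m)_u$ in a round $\le r$ and did not output $ack(m)_u$ in a round $<r$. Let $c(u,r)$ be the number of $G'$-neighbors of $u$ that are active (with some message) in round $r$, $c(u,r,r')=\max_{s\in[r,r']}c(u,s)$, and $c'(v,r,r')=\max_{u\in N_G(v)}c(u,r,r')$. "W.h.p." means with probability at least $1-1/n$, and $\log$ is the natural logarithm where no base is given. An algorithm *solves the local broadcast problem* if in every execution (1) each $bcast(m)_u$ is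 followed by exactly one $ack(m)_u$ and there are no other $ack$ outputs; (2) each $rcv(m)_v$ is output at most once, and if it is output in round $r$, then some $u\in N_{G'}(v)$ received $bcast(m)_u$ before round $r$ and has not output $ack(m)_u$ before round $r$; and (3) given any history that ends with the input $bcast(m)_u$ at the start of round $r$, w.h.p. all $v\in N_G(u)$ output $rcv(m)_v$ in $[r,r']$, where $r'$ is the round of $ack(m)_u$. It has *acknowledgment bound* $f_{ack}$ if, given any such history, w.h.p. $r'-r\le f_{ack}(c'(u,r,r'))$. It has *progress bound* $f_{prog}$ if for all rounds $r\le r'$ and every $u$, w.h.p. the following holds: if $r'-r>f_{prog}(c(u,r,r'))$ and some $v\in N_G(u)$ is active throughout $[r,r']$, then $u$ outputs $rcv(m)_u$ in a round $\le r'$ for some message $m$ that is active at some round in $[r,r']$. **Protocols.** Let $\Delta'$ be an integer with $1\le\Delta'\le n$ such that $c(u,r)\le\Delta'$ for all processes and rounds in every execution (for instance the maximum contention, if it is at least $1$). The processes know integers $N$ and $D$ with $n\le N\le n^a$ and $\Delta'\le D\le b\Delta'$, for constants $a,b$. For a constant $c$, phase $i$ has $\lfloor c\,2^i\log N\rfloor+1$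 rounds, in each of which a ready process transmits its message with probability $2^{-i}$. Put $\ell(x)=\lfloor\log_2 x\rfloor+1$. An epoch of SAP (with a constant $c_S$) consists of the phases $1,\dots,\ell(D)$; the epochs of all processes are aligned, a process is ready in an epoch with the message that it received before the start of the epoch, and it acknowledges that message at the end of the epoch. An epoch of APP (with a constant $c_A$) consists of the phases $1,\dots,\ell(D)+\ell(\ell(D))$; a process starts an epoch with the first round after it receives a message and is ready throughout it. *Interleaving SAP with APP* means: every message is given to both protocols, SAP runs in the odd rounds and APP in the even rounds, the message is acknowledged when SAP acknowledges it, and APP then stops working on it. A process outputs $rcv(m)$ when it receives another process's message $m$ from the channel for the first time. **Statement.** For all $a,b$ there are positive constants $c_S,c_A,C$ such that, for all $n,N,D,\Delta'$ as above and every network, bijection, environment and adversary as above, the interleaving of SAP with APP solves the local broadcast problem and has acknowledgment bound $$f_{ack}(k)=C\,\Delta'\log n$$ and progress bound $$f_{prog}(k)=C\,\min\{k\log(k+1)\log n,\ \Delta'\log n\}.$$ -/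

import Mathlib

open scoped NNReal ENNReal

noncomputable section

namespace LocalBroadcast

/-! ### Dual graph networks and distributed randomized algorithms -/

/-- A dual graph network: the reliable graph `G` and the graph `G'` of all (reliable and
unreliable) links, on the same set of nodes. -/
structure DualGraph (V : Type) where
  G : SimpleGraph V
  G' : SimpleGraph V
  le : G ≤ G'

/-- The outputs that a process hands to its higher layer at the end of a round: the set of the `m`
with an output `ack(m)` and the set of the `m` with an output `rcv(m)`. -/
structure Output (M : Type) where
  ack : Set M
  rcv : Set M

/-- A randomized process with messages in `M` from its environment and packets in `W` on the radio
channel.  In every round it takes at most one `bcast` input, makes a random step that also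
determines what it transmits (`none`: nothing), and, once it has been told what it receives
(`none`: silence), updates its state and generates outputs. -/
structure Automaton (M W : Type) where
  State : Type
  start : State
  act : State → Option M → PMF (State × Option W)
  finish : State → Option W → State × Output M

/-- A distributed algorithm: `n` processes, with the elements of `Fin n` as identifiers. -/
abbrev Algorithm (n : ℕ) (M W : Type) : Type 1 := Fin n → Automaton M W

/-- Independent draws from finitely many distributions. -/
def drawAll : (n : ℕ) → {α : Fin n → Type} → ((i : Fin n) → PMF (α i)) → PMF ((i : Fin n) → α i)
  | 0, _, _ => PMF.pure fun i => i.elim0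
  | n + 1, _, p => (p 0).bind fun x => (drawAll n fun i => p i.succ).map (Fin.cons x)

/-! ### Executions -/

section Executions

variable {n : ℕ} {M W V : Type}

/-- What happens in one round.  Inputs, transmissions, receptions and outputs are indexed by the
nodes, the states (at the end of the round) by the processes. -/
structure Round (V : Type) (A : Algorithm n M W) where
  input : V → Option M
  sent : V → Option W
  reach : SimpleGraph V
  received : V → Option W
  output : V → Output M
  state : (i : Fin n) → (A i).State

/-- A finite execution: the list of its rounds.  The rounds have the numbers `1, 2, …`. -/
abbrev History (V : Type) (A : Algorithm n M W) : Type := List (Round V A)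

/-- The states of all processes after the history `h`. -/
def History.state {A : Algorithm n M W} (h : History V A) : (i : Fin n) → (A i).State :=
  match h.getLast? with
  | none => fun i => (A i).start
  | some ρ => ρ.state

/-- The adversary.  Knowing the whole history (with all states) it chooses the `bcast` inputs of the
next round; when the processes have made their random choices for that round, it also chooses,
knowing those choices, the reach set of the round, which lies between `G` and `G'`. -/
structure Adversary (net : DualGraph V) (A : Algorithm n M W) where
  env : History V A → V → Option M
  reach : History V A → ((i : Fin n) → (A i).State × Option W) → SimpleGraph V
  le_reach : ∀ h x, net.G ≤ reach h x
  reach_le : ∀ h x, reach h x ≤ net.G'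

open Classical in
/-- What node `v` receives if the nodes transmit `sent` and the links in `R` work: its own packet if
it transmits, otherwise the packet of its only transmitting `R`-neighbor, and silence if there is no
transmitting `R`-neighbor or more than one. -/
def reception (R : SimpleGraph V) (sent : V → Option W) (v : V) : Option W :=
  if sent v ≠ none then sent v
  else if h : ∃! u, R.Adj v u ∧ sent u ≠ none then sent h.choose
  else none

/-- The round after the history `h`, if the processes make the random choices `x`. -/
def nextRound {net : DualGraph V} {A : Algorithm n M W} (proc : V ≃ Fin n) (adv : Adversary net A)
    (h : History V A) (x : (i : Fin n) → (A i).State × Option W) : Round V A :=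
  let sent : V → Option W := fun v => (x (proc v)).2
  let received : V → Option W := reception (adv.reach h x) sent
  { input := adv.env h
    sent := sent
    reach := adv.reach h x
    received := received
    output := fun v => ((A (proc v)).finish (x (proc v)).1 (received v)).2
    state := fun i => ((A i).finish (x i).1 (received (proc.symm i))).1 }

/-- The distribution of the history one round after `h`. -/
def step {net : DualGraph V} {A : Algorithm n M W} (proc : V ≃ Fin n) (adv : Adversary net A)
    (h : History V A) : PMF (History V A) :=
  (drawAll n fun i => (A i).act (h.state i) (adv.env h (proc.symm i))).map
    fun x => h ++ [nextRound proc adv h x]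

/-- The distribution of the history `k` rounds after `h`. -/
def run {net : DualGraph V} {A : Algorithm n M W} (proc : V ≃ Fin n) (adv : Adversary net A) :
    ℕ → History V A → PMF (History V A)
  | 0, h => PMF.pure h
  | k + 1, h => (step proc adv h).bind (run proc adv k)

/-- The finite executions that can occur. -/
def Reachable {net : DualGraph V} {A : Algorithm n M W} (proc : V ≃ Fin n) (adv : Adversary net A)
    (h : History V A) : Prop :=
  ∃ k, h ∈ (run proc adv k []).support

/-- The first `T` rounds of an infinite sequence of rounds. -/
def firstRounds {A : Algorithm n M W} (ω : ℕ → Round V A) (T : ℕ) : History V A :=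
  (List.range T).map ω

/-- The infinite executions. -/
def IsExecution {net : DualGraph V} {A : Algorithm n M W} (proc : V ≃ Fin n)
    (adv : Adversary net A) (ω : ℕ → Round V A) : Prop :=
  ∀ T, Reachable proc adv (firstRounds ω T)

/-- The event `S` has probability at least `1 - 1/n` under `p`. -/
def WHP {α : Type} (n : ℕ) (p : PMF α) (S : Set α) : Prop :=
  1 - (n : ℝ≥0∞)⁻¹ ≤ p.toOuterMeasure S

/-! ### Events, activity and contention in a finite execution -/

variable {A : Algorithm n M W}

/-- `ρ` is the round with number `r` of `h`. -/
def History.IsRound (h : History V A) (r : ℕ) (ρ : Round V A) : Prop :=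
  1 ≤ r ∧ h[r - 1]? = some ρ

/-- The input `bcast(m)_v` occurs in round `r`. -/
def History.Bcast (h : History V A) (v : V) (m : M) (r : ℕ) : Prop :=
  ∃ ρ, h.IsRound r ρ ∧ ρ.input v = some m

/-- The output `ack(m)_v` occurs in round `r`. -/
def History.Ack (h : History V A) (v : V) (m : M) (r : ℕ) : Prop :=
  ∃ ρ, h.IsRound r ρ ∧ m ∈ (ρ.output v).ack

/-- The output `rcv(m)_v` occurs in round `r`. -/
def History.Rcv (h : History V A) (v : V) (m : M) (r : ℕ) : Prop :=
  ∃ ρ, h.IsRound r ρ ∧ m ∈ (ρ.output v).rcv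

/-- The process at `v` is active with `m` in round `r`: it has received `bcast(m)_v` in a round
`≤ r` and has not output `ack(m)_v` before round `r` (outputs come at the end of a round). -/
def History.ActiveWith (h : History V A) (v : V) (m : M) (r : ℕ) : Prop :=
  (∃ s ≤ r, h.Bcast v m s) ∧ ∀ s < r, ¬ h.Ack v m s

/-- The process at `v` is active in round `r`. -/
def History.Active (h : History V A) (v : V) (r : ℕ) : Prop :=
  ∃ m, h.ActiveWith v m r

variable [Fintype V]

open Classical in
/-- `c(u, r)`: the number of `G'`-neighbors of `u` that are active in round `r`. -/
def contention (net : DualGraph V) (h : History V A) (u : V) (r : ℕ) : ℕ :=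
  (Finset.univ.filter fun w => net.G'.Adj u w ∧ h.Active w r).card

/-- `c(u, r, r')`: the maximum of `c(u, s)` over the rounds `s` in `[r, r']`. -/
def maxContention (net : DualGraph V) (h : History V A) (u : V) (r r' : ℕ) : ℕ :=
  (Finset.Icc r r').sup fun s => contention net h u s

open Classical in
/-- `c'(v, r, r')`: the maximum of `c(u, r, r')` over the `G`-neighbors `u` of `v`. -/
def nbrContention (net : DualGraph V) (h : History V A) (v : V) (r r' : ℕ) : ℕ :=
  (Finset.univ.filter fun u => net.G.Adj v u).sup fun u => maxContention net h u r r'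

/-! ### The local broadcast problem -/

/-- The environment is well-formed: no message is given as input twice, and a process only gets an
input if it has not had one before or if the last of its `bcast` and `ack` actions is an `ack`. -/
structure WellFormed {net : DualGraph V} (proc : V ≃ Fin n) (adv : Adversary net A) : Prop where
  fresh : ∀ h, Reachable proc adv h → ∀ u m, adv.env h u = some m → ∀ v r, ¬ h.Bcast v m r
  distinct : ∀ h, Reachable proc adv h → ∀ u v m,
    adv.env h u = some m → adv.env h v = some m → u = v
  alternate : ∀ h, Reachable proc adv h → ∀ u m, adv.env h u = some m →
    (∀ m' s, ¬ h.Bcast u m' s) ∨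
      ∃ m₀ r₀, h.Ack u m₀ r₀ ∧ ∀ m' s, h.Bcast u m' s → s ≤ r₀

/-- Against the adversary `adv`, the algorithm solves the local broadcast problem. -/
structure SolvesLocalBroadcast {net : DualGraph V} (proc : V ≃ Fin n) (adv : Adversary net A) :
    Prop where
  /-- In every execution, every `bcast(m)_u` is followed by exactly one `ack(m)_u`. -/
  ack_exists : ∀ ω, IsExecution proc adv ω → ∀ u m r, (∃ T, (firstRounds ω T).Bcast u m r) →
    ∃! r', r ≤ r' ∧ ∃ T, (firstRounds ω T).Ack u m r'
  /-- There are no other `ack` outputs. -/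
  ack_only : ∀ h, Reachable proc adv h → ∀ u m r', h.Ack u m r' → ∃ r ≤ r', h.Bcast u m r
  /-- Every `rcv(m)_v` is output at most once. -/
  rcv_unique : ∀ h, Reachable proc adv h → ∀ v m r r', h.Rcv v m r → h.Rcv v m r' → r = r'
  /-- If `rcv(m)_v` is output in round `r`, then some `G'`-neighbor of `v` has received `m` as input
  and has not acknowledged it, both before round `r`. -/
  rcv_sound : ∀ h, Reachable proc adv h → ∀ v m r, h.Rcv v m r →
    ∃ u, net.G'.Adj v u ∧ (∃ s < r, h.Bcast u m s) ∧ ∀ s < r, ¬ h.Ack u m s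
  /-- If `u` gets the input `bcast(m)_u` in the round `r` after a history `h`, then, given `h`, with
  high probability all `G`-neighbors of `u` have output `rcv(m)` from round `r` on when `u` outputs
  `ack(m)_u`. -/
  delivery : ∀ h, Reachable proc adv h → ∀ u m, adv.env h u = some m → ∀ T,
    WHP n (run proc adv T h) {x | ∀ r', h.length + 1 ≤ r' → x.Ack u m r' →
      ∀ v, net.G.Adj u v → ∃ s, h.length + 1 ≤ s ∧ s ≤ r' ∧ x.Rcv v m s}

/-- `f` is an acknowledgment bound: if `v` gets the input `bcast(m)_v` in the round `r` after a
history `h`, then, given `h`, with high probability `r' - r ≤ f(c'(v, r, r'))` for the round `r'` of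
the output `ack(m)_v`. -/
def HasAckBound {net : DualGraph V} (proc : V ≃ Fin n) (adv : Adversary net A) (f : ℕ → ℝ) : Prop :=
  ∀ h, Reachable proc adv h → ∀ v m, adv.env h v = some m → ∀ T,
    WHP n (run proc adv T h) {x | ∀ r', h.length + 1 ≤ r' → x.Ack v m r' →
      (r' : ℝ) - ((h.length + 1 : ℕ) : ℝ) ≤ f (nbrContention net x v (h.length + 1) r')}

/-- `f` is a progress bound: for all rounds `r ≤ r'` and every `u`, with high probability, if
`r' - r > f(c(u, r, r'))` and some `G`-neighbor of `u` is active throughout `[r, r']`, then `u`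
outputs `rcv(m)_u` in a round `≤ r'` for a message `m` that is active at some round in `[r, r']`. -/
def HasProgressBound {net : DualGraph V} (proc : V ≃ Fin n) (adv : Adversary net A) (f : ℕ → ℝ) :
    Prop :=
  ∀ r r' u, 1 ≤ r → r ≤ r' →
    WHP n (run proc adv r' []) {x |
      f (maxContention net x u r r') < (r' : ℝ) - (r : ℝ) →
      (∃ v, net.G.Adj u v ∧ ∀ s, r ≤ s → s ≤ r' → x.Active v s) →
      ∃ m, (∃ s ≤ r', x.Rcv u m s) ∧ ∃ w s, r ≤ s ∧ s ≤ r' ∧ x.ActiveWith w m s}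

end Executions

/-! ### Broadcast protocols and their execution by a process -/

/-- A protocol for broadcasting one message.  For a message that arrives in round `b` (for a protocol
that only owns some of the rounds: after its round `b` has begun and before its round `b + 1`), the
process transmits it in round `t` with probability `prob b t`, and acknowledges it at the end of
round `t` if `acks b t`. -/
structure Protocol where
  prob : ℕ → ℕ → ℝ≥0
  prob_le_one : ∀ b t, prob b t ≤ 1
  acks : ℕ → ℕ → Prop

/-- A coin that shows `true` with probability `p`. -/
def coin (p : ℝ≥0) (hp : p ≤ 1) : PMF Bool :=
  PMF.ofFintype (fun x => if x then (p : ℝ≥0∞) else 1 - p) (by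
    have h : (p : ℝ≥0∞) ≤ 1 := by exact_mod_cast hp
    simp [add_tsub_cancel_of_le h])

/-- The state of a process that executes a protocol: the number of the current round, the message
under transmission with the round of its arrival, and the messages that it has output by `rcv`. -/
structure ProtocolState (M : Type) where
  clock : ℕ
  current : Option (M × ℕ)
  delivered : Set M

open Classical in
/-- The process that executes the protocol `P`.  A message of another process that it receives on
the channel is output by `rcv` when it is received for the first time. -/
def Protocol.process (P : Protocol) (M : Type) : Automaton M M where
  State := ProtocolState M
  start := { clock := 0, current := none, delivered := ∅ }
  act := fun σ inp =>
    let t := σ.clock + 1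
    let cur : Option (M × ℕ) :=
      match inp with
      | some m => some (m, t)
      | none => σ.current
    let σ' : ProtocolState M := { clock := t, current := cur, delivered := σ.delivered }
    match cur with
    | none => PMF.pure (σ', none)
    | some (m, b) => (coin (P.prob b t) (P.prob_le_one b t)).map
        fun heads => (σ', if heads then some m else none)
  finish := fun σ packet =>
    let ack : Set M := {m | ∃ b, σ.current = some (m, b) ∧ P.acks b σ.clock}
    let rcv : Set M := {m | packet = some m ∧ m ∉ σ.delivered ∧ ∀ b, σ.current ≠ some (m, b)}
    ({ clock := σ.clock
       current := if ack.Nonempty then none else σ.current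
       delivered := σ.delivered ∪ rcv },
     { ack := ack, rcv := rcv })

/-! ### SAP, APP and their interleaving

`N` and `D` are the bounds on the number of nodes and on the contention that the processes know, and
`c` is the constant that the `Θ` in the phase lengths stands for. -/

/-- The number `Θ(2 ^ i log n)` of rounds in phase `i`. -/
def phaseLength (c : ℝ) (N i : ℕ) : ℕ := ⌊c * 2 ^ i * Real.log N⌋₊ + 1

/-- The number of rounds in the phases `1, …, k`. -/
def epochLength (c : ℝ) (N k : ℕ) : ℕ := ∑ i ∈ Finset.Icc 1 k, phaseLength c N i

/-- The phase of the round with offset `s` (`s = 0` for the first round) in an epoch, that is, the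
`i` with `epochLength c N (i - 1) ≤ s < epochLength c N i`. -/
def phaseAt (c : ℝ) (N s : ℕ) : ℕ := sInf {i | s < epochLength c N i}

/-- The transmission probability `2⁻ⁱ` at offset `s`, where `i` is the phase. -/
def phaseProb (c : ℝ) (N s : ℕ) : ℝ≥0 := 2⁻¹ ^ phaseAt c N s

theorem phaseProb_le_one (c : ℝ) (N s : ℕ) : phaseProb c N s ≤ 1 :=
  pow_le_one' (inv_le_one_of_one_le₀ one_le_two) _

/-- `log Δ'` (to base 2), rounded. -/
def logPhases (D : ℕ) : ℕ := Nat.log 2 D + 1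

/-- The length of an epoch of SAP, which has `log Δ'` phases. -/
def sapLength (c : ℝ) (N D : ℕ) : ℕ := epochLength c N (logPhases D)

/-- The length of an epoch of APP, which has `log Δ' + log log Δ'` phases. -/
def appLength (c : ℝ) (N D : ℕ) : ℕ := epochLength c N (logPhases D + logPhases (logPhases D))

/-- The number of rounds of SAP before the epoch that contains round `t`. -/
def sapEpochStart (c : ℝ) (N D t : ℕ) : ℕ := (t - 1) / sapLength c N D * sapLength c N D

/-- The synchronous acknowledgment protocol: the epochs are aligned, a process is ready with a
message in an epoch if the message has arrived before the start of the epoch, and the message is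
acknowledged at the end of that epoch. -/
def SAP (c : ℝ) (N D : ℕ) : Protocol where
  prob := fun b t =>
    if b ≤ sapEpochStart c N D t then phaseProb c N (t - 1 - sapEpochStart c N D t) else 0
  prob_le_one := fun b t => by
    split_ifs
    · exact phaseProb_le_one _ _ _
    · exact zero_le_one
  acks := fun b t =>
    b ≤ sapEpochStart c N D t ∧ t = sapEpochStart c N D t + sapLength c N D

/-- The asynchronous progress protocol: an epoch of a process starts immediately after the arrival
of a message, and the message is acknowledged at the end of that epoch. -/
def APP (c : ℝ) (N D : ℕ) : Protocol where
  prob := fun b t =>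
    if b < t ∧ t ≤ b + appLength c N D then phaseProb c N (t - 1 - b) else 0
  prob_le_one := fun b t => by
    split_ifs
    · exact phaseProb_le_one _ _ _
    · exact zero_le_one
  acks := fun b t => t = b + appLength c N D

/-- The interleaving of `P` (in the odd rounds) and `Q` (in the even rounds): a message is given to
both protocols, and it is acknowledged, and `Q` also finishes working on it, when `P` acknowledges
it. The odd round `t` is round `(t + 1) / 2` of `P` and the even round `t` is round `t / 2` of `Q`;
`(b + 1) / 2` odd rounds and `b / 2` even rounds have begun when a message arrives in round `b`. -/
def Protocol.interleave (P Q : Protocol) : Protocol where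
  prob := fun b t =>
    if Odd t then P.prob ((b + 1) / 2) ((t + 1) / 2) else Q.prob (b / 2) (t / 2)
  prob_le_one := fun b t => by
    split_ifs
    · exact P.prob_le_one _ _
    · exact Q.prob_le_one _ _
  acks := fun b t => Odd t ∧ P.acks ((b + 1) / 2) ((t + 1) / 2)

/-- The distributed algorithm in which all `n` processes execute the interleaving of SAP and APP. -/
def sapApp (cS cA : ℝ) (N D n : ℕ) (M : Type) : Algorithm n M M :=
  fun _ => ((SAP cS N D).interleave (APP cA N D)).process M

end LocalBroadcast

end

noncomputable section

namespace LocalBroadcast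

/-! ### Discrete distributions -/

/-! Let L be the length of a SAP epoch. In the interleaving, acknowledgments occur only in the
rounds 2(j+1)L − 1. Time thus splits into blocks of rounds 2jL, …, 2(j+1)L − 1, inside which
messages may arrive but none is dropped before the end of the last round. Within a block activity
and contention only grow (`loaded_of_loaded`, `contention_mono`), so the contention at the end of a
window bounds that of all its rounds. The acknowledgment bound is deterministic: a message waits for
the next block and is acknowledged in its last round, at most 4L = O(Δ' log n) rounds after its
arrival (`ack_round`).

Randomness enters through one estimate, `run_failure_le`: the probability that no round succeeds
although the conditional success probabilities along the path add up to at least Q is at most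
exp(−Q). The sum is read off the path, so contention, sender and message may depend on the whole
execution, as the adaptive environment makes them do; only the notion of success is fixed
beforehand. It remains to bound such sums from below. Since the adversary chooses the links after
seeing the coins, a reception is forced by letting one G-neighbor transmit while all other
candidates in G' are silent (`le_step_of_received`).

In SAP all ready processes use the same probability 2⁻ⁱ. If the contention is at most 2ⁱ, a round of
phase i succeeds with probability at least 2⁻ⁱ/4, and the phase contributes c log N / 4
(`le_sum_sap`). The last phase of the epoch and a union bound over the receivers give delivery.

In APP the epochs are not aligned. During phase i of the sender, a rival transmits O(i log N) times
in expectation wherever its own epoch started, because the probabilities decrease along an epoch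
(`sum_window_le`) and every phase contributes O(log N). If 2ⁱ ≥ 8ki, then k rivals together transmit
on average at most 1/4 packet per round, and the phase again contributes c log N / 4 (`le_sum_app`).
Such an i exists with 2ⁱ = O(k log(k+1)), which is the source of the progress bound. A window of
rounds either contains a full block, where SAP succeeds, or has about half of its length in one
block (`exists_piece`); there SAP serves the messages older than the block and APP those that
arrived during it. -/

theorem toOuterMeasure_drawAll : ∀ (n : ℕ) {α : Fin n → Type} (p : (i : Fin n) → PMF (α i))
    (S : (i : Fin n) → Set (α i)),
    (drawAll n p).toOuterMeasure {x | ∀ i, x i ∈ S i} = ∏ i, (p i).toOuterMeasure (S i)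
  | 0, _, p, S => by
    have h : {x : (i : Fin 0) → _ | ∀ i, x i ∈ S i} = Set.univ := by
      ext x; simp
    rw [h, drawAll, PMF.toOuterMeasure_pure_apply]
    simp
  | n + 1, α, p, S => by
    classical
    rw [drawAll, PMF.toOuterMeasure_bind_apply, Fin.prod_univ_succ]
    have h : ∀ a : α 0, ((drawAll n fun i => p i.succ).map
        (Fin.cons (α := α) a)).toOuterMeasure {x | ∀ i, x i ∈ S i} =
        (S 0).indicator 1 a * ∏ i : Fin n, (p i.succ).toOuterMeasure (S i.succ) := by
      intro a
      rw [PMF.toOuterMeasure_map_apply]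
      by_cases ha : a ∈ S 0
      · rw [← toOuterMeasure_drawAll n (fun i => p i.succ) fun i => S i.succ]
        simp only [ha, Set.indicator_of_mem, Pi.one_apply, one_mul]
        congr 1
        ext x
        simp [Fin.forall_fin_succ, ha]
      · simp only [ha, not_false_eq_true, Set.indicator_of_notMem, zero_mul]
        have : (Fin.cons (α := α) a) ⁻¹' {x | ∀ i, x i ∈ S i} = ∅ := by
          ext x
          simp [Fin.forall_fin_succ, ha]
        rw [this]
        simp
    simp_rw [h, ← mul_assoc]
    rw [ENNReal.tsum_mul_right, PMF.toOuterMeasure_apply]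
    congr 1
    refine tsum_congr fun a => ?_
    by_cases ha : a ∈ S 0 <;> simp [ha]

theorem mem_support_of_mem_support_drawAll {n : ℕ} {α : Fin n → Type} {p : (i : Fin n) → PMF (α i)}
    {x : (i : Fin n) → α i} (hx : x ∈ (drawAll n p).support) (i : Fin n) : x i ∈ (p i).support := by
  have h := toOuterMeasure_drawAll n p fun i => {x i}
  have hs : {y : (i : Fin n) → α i | ∀ i, y i ∈ ({x i} : Set (α i))} = {x} := by
    ext y
    simp [funext_iff]
  rw [hs] at h
  simp only [PMF.toOuterMeasure_apply_singleton] at h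
  rw [PMF.mem_support_iff] at hx ⊢
  intro h0
  exact hx (h.trans (Finset.prod_eq_zero (Finset.mem_univ i) h0))

theorem toOuterMeasure_le_one {α : Type} (p : PMF α) (S : Set α) : p.toOuterMeasure S ≤ 1 := by
  calc p.toOuterMeasure S ≤ p.toOuterMeasure Set.univ := p.toOuterMeasure.mono (Set.subset_univ S)
    _ = 1 := by
      rw [PMF.toOuterMeasure_apply_eq_one_iff]
      exact Set.subset_univ _

theorem toOuterMeasure_add_compl {α : Type} (p : PMF α) (S : Set α) :
    p.toOuterMeasure S + p.toOuterMeasure Sᶜ = 1 := by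
  rw [PMF.toOuterMeasure_apply, PMF.toOuterMeasure_apply, ← ENNReal.tsum_add, ← p.tsum_coe]
  refine tsum_congr fun a => ?_
  by_cases ha : a ∈ S <;> simp [ha]

theorem WHP.of_compl_le {α : Type} {n : ℕ} {p : PMF α} {S B : Set α}
    (h : ∀ x ∈ p.support, x ∉ S → x ∈ B) (hB : p.toOuterMeasure B ≤ (n : ℝ≥0∞)⁻¹) :
    WHP n p S := by
  have h1 : p.toOuterMeasure Sᶜ ≤ p.toOuterMeasure B :=
    PMF.toOuterMeasure_mono p fun x hx => h x hx.2 hx.1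
  rw [WHP, tsub_le_iff_right, ← toOuterMeasure_add_compl p S]
  gcongr
  exact h1.trans hB

theorem WHP.of_forall {α : Type} {n : ℕ} {p : PMF α} {S : Set α} (h : ∀ x ∈ p.support, x ∈ S) :
    WHP n p S :=
  WHP.of_compl_le (B := ∅) (fun x hx hS => hS (h x hx)) (by simp)

/-- For n = 1 the required probability 1 − 1/n is zero. This removes the case in which log n
vanishes and the estimates of the phase lengths break down. -/
theorem WHP.one {α : Type} (p : PMF α) (S : Set α) : WHP 1 p S := by
  simp [WHP]

theorem coin_apply (p : ℝ≥0) (hp : p ≤ 1) (x : Bool) :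
    coin p hp x = if x then (p : ℝ≥0∞) else 1 - p := rfl

/-! ### Runs -/

section Run

variable {n : ℕ} {M W V : Type} {A : Algorithm n M W} {net : DualGraph V} {proc : V ≃ Fin n}
  {adv : Adversary net A}

/-- `run` peels off the first round, which suits the probability estimate; facts about reachable
histories are proved by peeling off the last one. -/
theorem run_succ' (k : ℕ) (h : History V A) :
    run proc adv (k + 1) h = (run proc adv k h).bind (step proc adv) := by
  induction k generalizing h with
  | zero => simp [run, PMF.pure_bind]
  | succ k ih =>
    change (step proc adv h).bind (run proc adv (k + 1)) =
      ((step proc adv h).bind (run proc adv k)).bind (step proc adv)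
    rw [PMF.bind_bind]
    congr 1
    funext y
    exact ih y

theorem mem_support_step {h y : History V A} (hy : y ∈ (step proc adv h).support) :
    ∃ x : (i : Fin n) → (A i).State × Option W,
      (∀ i, x i ∈ ((A i).act (h.state i) (adv.env h (proc.symm i))).support) ∧
        y = h ++ [nextRound proc adv h x] := by
  rw [step, PMF.mem_support_map_iff] at hy
  obtain ⟨x, hx, rfl⟩ := hy
  exact ⟨x, mem_support_of_mem_support_drawAll hx, rfl⟩

theorem Reachable.nil : Reachable proc adv [] := ⟨0, by simp [run]⟩

theorem Reachable.step {h y : History V A} (hh : Reachable proc adv h)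
    (hy : y ∈ (step proc adv h).support) : Reachable proc adv y := by
  obtain ⟨k, hk⟩ := hh
  refine ⟨k + 1, ?_⟩
  rw [run_succ', PMF.mem_support_bind_iff]
  exact ⟨h, hk, hy⟩

theorem Reachable.rec_step {p : History V A → Prop} (nil : p [])
    (step : ∀ h y, Reachable proc adv h → p h → y ∈ (LocalBroadcast.step proc adv h).support → p y)
    {h : History V A} (hh : Reachable proc adv h) : p h := by
  obtain ⟨k, hk⟩ := hh
  induction k generalizing h with
  | zero =>
    have : h = [] := by simpa [run] using hk
    exact this ▸ nil
  | succ k ih =>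
    rw [run_succ', PMF.mem_support_bind_iff] at hk
    obtain ⟨y, hy, hk⟩ := hk
    exact step y h ⟨k, hy⟩ (ih hy) hk

theorem Reachable.run {h x : History V A} (hh : Reachable proc adv h) {k : ℕ}
    (hx : x ∈ (run proc adv k h).support) : Reachable proc adv x := by
  induction k generalizing x with
  | zero =>
    have : x = h := by simpa [LocalBroadcast.run] using hx
    exact this ▸ hh
  | succ k ih =>
    rw [run_succ', PMF.mem_support_bind_iff] at hx
    obtain ⟨y, hy, hx⟩ := hx
    exact (ih hy).step hx

theorem length_of_mem_support_run {h x : History V A} {k : ℕ}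
    (hx : x ∈ (run proc adv k h).support) : x.length = h.length + k := by
  induction k generalizing x with
  | zero =>
    have : x = h := by simpa [run] using hx
    simp [this]
  | succ k ih =>
    rw [run_succ', PMF.mem_support_bind_iff] at hx
    obtain ⟨y, hy, hx⟩ := hx
    obtain ⟨z, -, rfl⟩ := mem_support_step hx
    simp [ih hy]
    omega

theorem take_of_mem_support_run {h x : History V A} {k : ℕ}
    (hx : x ∈ (run proc adv k h).support) : x.take h.length = h := by
  induction k generalizing x with
  | zero =>
    have : x = h := by simpa [run] using hx
    simp [this]
  | succ k ih =>
    rw [run_succ', PMF.mem_support_bind_iff] at hx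
    obtain ⟨y, hy, hx⟩ := hx
    obtain ⟨z, -, rfl⟩ := mem_support_step hx
    rw [List.take_append_of_le_length, ih hy]
    rw [length_of_mem_support_run hy]
    omega

theorem Reachable.take {h : History V A} (hh : Reachable proc adv h) (t : ℕ) :
    Reachable proc adv (h.take t) := by
  refine Reachable.rec_step (p := fun h => Reachable proc adv (h.take t)) ?_ ?_ hh
  · simpa using Reachable.nil
  · intro h y hh ih hy
    obtain ⟨x, -, rfl⟩ := mem_support_step hy
    rcases le_or_gt t h.length with ht | ht
    · rwa [List.take_append_of_le_length ht]
    · rw [List.take_of_length_le (by simpa using ht)]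
      exact hh.step hy

theorem Reachable.take_succ {h : History V A} (hh : Reachable proc adv h) {t : ℕ}
    (ht : t < h.length) :
    h.take (t + 1) ∈ (LocalBroadcast.step proc adv (h.take t)).support := by
  revert ht
  refine Reachable.rec_step (p := fun h => t < h.length →
    h.take (t + 1) ∈ (LocalBroadcast.step proc adv (h.take t)).support) ?_ ?_ hh
  · simp
  · intro h y hh ih hy ht
    obtain ⟨x, -, rfl⟩ := mem_support_step hy
    rcases lt_or_ge t h.length with h1 | h1
    · rw [List.take_append_of_le_length h1, List.take_append_of_le_length h1.le]
      exact ih h1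
    · have : t = h.length := by
        simp at ht
        omega
      subst this
      rw [List.take_left, List.take_of_length_le (by simp)]
      exact hy

/-- If in every round the conditional probability of success is accounted for, it is unlikely that
these probabilities add up to `Q` while no round is a success. -/
theorem run_failure_le (Succ : History V A → Prop) (k : ℕ) (h : History V A) (Q : ℝ) :
    (run proc adv k h).toOuterMeasure {x |
      (∀ t, h.length ≤ t → t < h.length + k → ¬ Succ (x.take (t + 1))) ∧
      Q ≤ ∑ t ∈ Finset.Ico h.length (h.length + k),
        ((step proc adv (x.take t)).toOuterMeasure {y | Succ y}).toReal} ≤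
      ENNReal.ofReal (Real.exp (-Q)) := by
  induction k generalizing h Q with
  | zero =>
    -- Over zero rounds the sum is 0: the bound is trivial for Q ≤ 0, and the event is empty for Q >
    -- 0.
    rcases le_or_gt Q 0 with hQ | hQ
    · refine (toOuterMeasure_le_one _ _).trans ?_
      rw [← ENNReal.ofReal_one]
      exact ENNReal.ofReal_le_ofReal (by simpa using hQ)
    · have : {x : History V A | (∀ t, h.length ≤ t → t < h.length + 0 → ¬ Succ (x.take (t + 1))) ∧
          Q ≤ ∑ t ∈ Finset.Ico h.length (h.length + 0),
          ((step proc adv (x.take t)).toOuterMeasure {y | Succ y}).toReal} = ∅ := by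
        ext x
        simp [hQ]
      rw [this]
      simp
  | succ k ih =>
    set q : ℝ := ((step proc adv h).toOuterMeasure {y | Succ y}).toReal with hq
    have hqe : (step proc adv h).toOuterMeasure {y | Succ y} = ENNReal.ofReal q :=
      (ENNReal.ofReal_toReal (ne_top_of_le_ne_top ENNReal.one_ne_top
        (toOuterMeasure_le_one _ _))).symm
    have hq1 : q ≤ 1 := by
      rw [← ENNReal.ofReal_le_one, ← hqe]
      exact toOuterMeasure_le_one _ _
    have hc : (step proc adv h).toOuterMeasure {y | Succ y}ᶜ = ENNReal.ofReal (1 - q) := by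
      have h1 := toOuterMeasure_add_compl (step proc adv h) {y | Succ y}
      rw [hqe] at h1
      rw [ENNReal.ofReal_sub _ ENNReal.toReal_nonneg, ENNReal.ofReal_one, ← h1,
        ENNReal.add_sub_cancel_left ENNReal.ofReal_ne_top]
    rw [run, PMF.toOuterMeasure_bind_apply]
    -- The first round must fail, which leaves mass 1 − q, and the later rounds must then account
    -- for Q − q. This may be negative, so the induction runs over all real Q.
    calc _ ≤ ∑' y, ({y | Succ y}ᶜ).indicator (step proc adv h) y *
          ENNReal.ofReal (Real.exp (-(Q - q))) := by
          refine ENNReal.tsum_le_tsum fun y => ?_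
          by_cases hy : y ∈ (step proc adv h).support
          swap
          · rw [PMF.mem_support_iff, not_not] at hy
            simp [hy]
          obtain ⟨z, -, hz⟩ := mem_support_step hy
          have hlen : y.length = h.length + 1 := by simp [hz]
          by_cases hS : Succ y
          · rw [Set.indicator_of_notMem (by simpa using hS), zero_mul, nonpos_iff_eq_zero,
              mul_eq_zero]
            right
            rw [PMF.toOuterMeasure_apply_eq_zero_iff, Set.disjoint_left]
            rintro x hx ⟨h1, -⟩
            refine h1 h.length le_rfl (by omega) ?_
            rw [← hlen, take_of_mem_support_run hx]
            exact hS
          · rw [Set.indicator_of_mem (by simpa using hS)]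
            gcongr
            refine le_trans ?_ (ih y (Q - q))
            refine PMF.toOuterMeasure_mono _ ?_
            rintro x ⟨⟨h1, h2⟩, hx⟩
            refine ⟨fun t ht1 ht2 => h1 t (by omega) (by omega), ?_⟩
            rw [Finset.sum_eq_sum_Ico_succ_bot (by omega)] at h2
            have h3 : x.take h.length = h := by
              have := take_of_mem_support_run hx
              rw [hlen] at this
              have h4 : (x.take (h.length + 1)).take h.length = y.take h.length := by rw [this]
              rw [List.take_take, min_eq_left (by omega), hz, List.take_left] at h4
              exact h4
            rw [h3, ← hq] at h2
            rw [hlen, show h.length + 1 + k = h.length + (k + 1) by ring]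
            linarith
      _ = ENNReal.ofReal (1 - q) * ENNReal.ofReal (Real.exp (-(Q - q))) := by
          rw [ENNReal.tsum_mul_right, ← hc, PMF.toOuterMeasure_apply]
      _ ≤ ENNReal.ofReal (Real.exp (-Q)) := by
          rw [← ENNReal.ofReal_mul (by linarith)]
          refine ENNReal.ofReal_le_ofReal ?_
          calc (1 - q) * Real.exp (-(Q - q)) ≤ Real.exp (-q) * Real.exp (-(Q - q)) := by
                gcongr
                linarith [Real.add_one_le_exp (-q)]
            _ = Real.exp (-Q) := by
                rw [← Real.exp_add]
                ring_nf

end Run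

/-! ### Events of extended and of truncated histories -/

section Events

variable {n : ℕ} {M W V : Type} {A : Algorithm n M W}

theorem History.isRound_append {h : History V A} {ρ ρ' : Round V A} {r : ℕ} :
    History.IsRound (h ++ [ρ]) r ρ' ↔ h.IsRound r ρ' ∨ (r = h.length + 1 ∧ ρ' = ρ) := by
  unfold History.IsRound
  rcases lt_trichotomy (r - 1) h.length with hr | hr | hr
  · rw [List.getElem?_append_left hr]
    constructor
    · exact Or.inl
    · rintro (h1 | ⟨h1, -⟩)
      · exact h1
      · omega
  · rw [hr, List.getElem?_concat_length, List.getElem?_eq_none le_rfl]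
    constructor
    · rintro ⟨h1, h2⟩
      exact Or.inr ⟨by omega, (Option.some.inj h2).symm⟩
    · rintro (⟨-, h1⟩ | ⟨h1, rfl⟩)
      · cases h1
      · exact ⟨by omega, rfl⟩
  · rw [List.getElem?_eq_none (by simp; omega), List.getElem?_eq_none hr.le]
    constructor
    · rintro ⟨-, h1⟩
      cases h1
    · rintro (⟨-, h1⟩ | ⟨h1, rfl⟩)
      · cases h1
      · omega

theorem History.IsRound.le_length {h : History V A} {ρ : Round V A} {r : ℕ}
    (hr : h.IsRound r ρ) : 1 ≤ r ∧ r ≤ h.length := by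
  obtain ⟨h1, h2⟩ := hr
  obtain ⟨h3, -⟩ := List.getElem?_eq_some_iff.1 h2
  omega

theorem History.isRound_take {h : History V A} {ρ : Round V A} {r t : ℕ} :
    History.IsRound (h.take t) r ρ ↔ r ≤ t ∧ h.IsRound r ρ := by
  unfold History.IsRound
  rw [List.getElem?_take]
  split_ifs with h1
  · constructor
    · rintro ⟨h2, h3⟩
      exact ⟨by omega, h2, h3⟩
    · rintro ⟨-, h2⟩
      exact h2
  · constructor
    · rintro ⟨-, h2⟩
      cases h2
    · rintro ⟨h2, h3, -⟩
      omega

variable {h : History V A} {ρ : Round V A} {v : V} {m : M} {r t : ℕ}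

theorem History.bcast_append :
    History.Bcast (h ++ [ρ]) v m r ↔ h.Bcast v m r ∨ (r = h.length + 1 ∧ ρ.input v = some m) := by
  unfold History.Bcast
  simp only [History.isRound_append, or_and_right, exists_or, and_assoc, exists_and_left,
    exists_eq_left]

theorem History.ack_append :
    History.Ack (h ++ [ρ]) v m r ↔ h.Ack v m r ∨ (r = h.length + 1 ∧ m ∈ (ρ.output v).ack) := by
  unfold History.Ack
  simp only [History.isRound_append, or_and_right, exists_or, and_assoc, exists_and_left,
    exists_eq_left]

theorem History.rcv_append :
    History.Rcv (h ++ [ρ]) v m r ↔ h.Rcv v m r ∨ (r = h.length + 1 ∧ m ∈ (ρ.output v).rcv) := by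
  unfold History.Rcv
  simp only [History.isRound_append, or_and_right, exists_or, and_assoc, exists_and_left,
    exists_eq_left]

theorem History.bcast_take : History.Bcast (h.take t) v m r ↔ r ≤ t ∧ h.Bcast v m r := by
  simp only [History.Bcast, History.isRound_take, and_assoc, exists_and_left]

theorem History.ack_take : History.Ack (h.take t) v m r ↔ r ≤ t ∧ h.Ack v m r := by
  simp only [History.Ack, History.isRound_take, and_assoc, exists_and_left]

theorem History.rcv_take : History.Rcv (h.take t) v m r ↔ r ≤ t ∧ h.Rcv v m r := by
  simp only [History.Rcv, History.isRound_take, and_assoc, exists_and_left]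

theorem History.Bcast.le_length (hb : h.Bcast v m r) : 1 ≤ r ∧ r ≤ h.length := by
  obtain ⟨ρ, hρ, -⟩ := hb
  exact hρ.le_length

theorem History.Ack.le_length (hb : h.Ack v m r) : 1 ≤ r ∧ r ≤ h.length := by
  obtain ⟨ρ, hρ, -⟩ := hb
  exact hρ.le_length

theorem History.Rcv.le_length (hb : h.Rcv v m r) : 1 ≤ r ∧ r ≤ h.length := by
  obtain ⟨ρ, hρ, -⟩ := hb
  exact hρ.le_length

theorem History.not_bcast_nil : ¬ History.Bcast ([] : History V A) v m r := fun hb => by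
  have := hb.le_length
  simp at this
  omega

theorem History.not_ack_nil : ¬ History.Ack ([] : History V A) v m r := fun hb => by
  have := hb.le_length
  simp at this
  omega

theorem History.not_rcv_nil : ¬ History.Rcv ([] : History V A) v m r := fun hb => by
  have := hb.le_length
  simp at this
  omega

theorem History.state_append : History.state (h ++ [ρ]) = ρ.state := by
  simp [History.state]

end Events

/-! ### The radio channel -/

section Reception

variable {V W : Type} {R : SimpleGraph V} {sent : V → Option W} {v : V} {m : W}

theorem reception_eq_some (hv : sent v = none) (hm : reception R sent v = some m) :
    ∃ u, R.Adj v u ∧ sent u = some m := by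
  unfold reception at hm
  rw [if_neg (by simpa using hv)] at hm
  split_ifs at hm with h
  exact ⟨h.choose, h.choose_spec.1.1, hm⟩

theorem reception_of_unique {u : V} (hv : sent v = none) (huv : R.Adj v u) (hu : sent u = some m)
    (hw : ∀ w, w ≠ u → R.Adj v w → sent w = none) : reception R sent v = some m := by
  have h : ∃! u, R.Adj v u ∧ sent u ≠ none := by
    refine ⟨u, ⟨huv, by simp [hu]⟩, ?_⟩
    rintro w ⟨hw1, hw2⟩
    by_contra hne
    exact hw2 (hw w hne hw1)
  unfold reception
  rw [if_neg (by simpa using hv), dif_pos h, ← h.unique ⟨huv, by simp [hu]⟩ h.choose_spec.1]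
  exact hu

theorem reception_of_sent (hv : sent v ≠ none) : reception R sent v = sent v := by
  unfold reception
  rw [if_pos hv]

end Reception

/-! ### Executions of a protocol by all processes -/

/-- The algorithm in which all processes execute `P`. -/
abbrev Protocol.algorithm (P : Protocol) (n : ℕ) (M : Type) : Algorithm n M M :=
  fun _ => P.process M

section Execution

variable {n : ℕ} {M V : Type} {P : Protocol} {net : DualGraph V}

/-- The state of the process at `v` after `h`. -/
def nodeState (proc : V ≃ Fin n) (h : History V (P.algorithm n M)) (v : V) : ProtocolState M :=
  h.state (proc v)

/-- The message, with its arrival round, on which the process at `v` works in the round after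
`h`. -/
def loaded (proc : V ≃ Fin n) (adv : Adversary net (P.algorithm n M))
    (h : History V (P.algorithm n M)) (v : V) : Option (M × ℕ) :=
  match adv.env h v with
  | some m => some (m, (nodeState proc h v).clock + 1)
  | none => (nodeState proc h v).current

/-- The probability that `v` transmits in the round after `h`. -/
def sendProb (proc : V ≃ Fin n) (adv : Adversary net (P.algorithm n M))
    (h : History V (P.algorithm n M)) (v : V) : ℝ≥0 :=
  match loaded proc adv h v with
  | some (_, b) => P.prob b ((nodeState proc h v).clock + 1)
  | none => 0

variable {proc : V ≃ Fin n} {adv : Adversary net (P.algorithm n M)}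

theorem sendProb_le_one (h : History V (P.algorithm n M)) (v : V) : sendProb proc adv h v ≤ 1 := by
  unfold sendProb
  split
  · exact P.prob_le_one _ _
  · exact zero_le_one

theorem act_eq (h : History V (P.algorithm n M)) (v : V) :
    (P.process M).act (nodeState proc h v) (adv.env h v) =
      match loaded proc adv h v with
      | none => PMF.pure (⟨(nodeState proc h v).clock + 1, none, (nodeState proc h v).delivered⟩,
          none)
      | some (m, b) => (coin (P.prob b ((nodeState proc h v).clock + 1)) (P.prob_le_one _ _)).map
          fun heads => (⟨(nodeState proc h v).clock + 1, some (m, b),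
            (nodeState proc h v).delivered⟩, if heads then some m else none) := by
  unfold loaded Protocol.process
  cases h1 : adv.env h v with
  | some m => simp
  | none =>
    cases h2 : (nodeState proc h v).current with
    | none => simp [h2]
    | some m => simp [h2]

theorem coin_map_true {α : Type} (p : ℝ≥0) (hp : p ≤ 1) (f : Bool → α) (S : Set α)
    (h1 : f true ∈ S) (h2 : f false ∉ S) : ((coin p hp).map f).toOuterMeasure S = p := by
  rw [PMF.toOuterMeasure_map_apply, PMF.toOuterMeasure_apply, tsum_fintype]
  simp [coin_apply, h1, h2, Set.indicator]

theorem coin_map_false {α : Type} (p : ℝ≥0) (hp : p ≤ 1) (f : Bool → α) (S : Set α)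
    (h1 : f true ∉ S) (h2 : f false ∈ S) :
    ((coin p hp).map f).toOuterMeasure S = ((1 - p : ℝ≥0) : ℝ≥0∞) := by
  rw [PMF.toOuterMeasure_map_apply, PMF.toOuterMeasure_apply, tsum_fintype]
  simp [coin_apply, h1, h2, Set.indicator]

theorem act_none (h : History V (P.algorithm n M)) (v : V) :
    ((P.process M).act (nodeState proc h v) (adv.env h v)).toOuterMeasure {y | y.2 = none} =
      ((1 - sendProb proc adv h v : ℝ≥0) : ℝ≥0∞) := by
  rw [act_eq]
  unfold sendProb
  rcases loaded proc adv h v with _ | ⟨m, b⟩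
  · simp
  · exact coin_map_false _ _ _ _ (by simp) (by simp)

theorem act_some (h : History V (P.algorithm n M)) (v : V) {m : M} {b : ℕ}
    (hl : loaded proc adv h v = some (m, b)) :
    ((P.process M).act (nodeState proc h v) (adv.env h v)).toOuterMeasure {y | y.2 = some m} =
      (sendProb proc adv h v : ℝ≥0∞) := by
  rw [act_eq]
  unfold sendProb
  rw [hl]
  exact coin_map_true _ _ _ _ (by simp) (by simp)

theorem mem_support_act {h : History V (P.algorithm n M)} {v : V} {y : ProtocolState M × Option M}
    (hy : y ∈ ((P.process M).act (nodeState proc h v) (adv.env h v)).support) :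
    y.1 = ⟨(nodeState proc h v).clock + 1, loaded proc adv h v, (nodeState proc h v).delivered⟩ ∧
      ∀ m, y.2 = some m → ∃ b, loaded proc adv h v = some (m, b) ∧
        P.prob b ((nodeState proc h v).clock + 1) ≠ 0 := by
  rw [act_eq] at hy
  rcases hl : loaded proc adv h v with _ | ⟨m, b⟩
  · rw [hl] at hy
    have h1 : y = (⟨(nodeState proc h v).clock + 1, none, (nodeState proc h v).delivered⟩, none) :=
      (PMF.mem_support_pure_iff _ _).1 hy
    subst h1
    simp
  · rw [hl] at hy
    obtain ⟨x, hx, rfl⟩ := (PMF.mem_support_map_iff _ _ _).1 hy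
    refine ⟨rfl, fun m' hm' => ?_⟩
    rw [PMF.mem_support_iff, coin_apply] at hx
    cases x
    · simp at hm'
    · simp only [if_true, Option.some.injEq] at hm'
      subst hm'
      exact ⟨b, rfl, by simpa using hx⟩

/-- What is known about the round `ρ` after the history `h`. -/
structure IsNext (proc : V ≃ Fin n) (adv : Adversary net (P.algorithm n M))
    (h : History V (P.algorithm n M)) (ρ : Round V (P.algorithm n M)) : Prop where
  input : ρ.input = adv.env h
  le_reach : net.G ≤ ρ.reach
  reach_le : ρ.reach ≤ net.G'
  sent : ∀ v m, ρ.sent v = some m → ∃ b, loaded proc adv h v = some (m, b) ∧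
    P.prob b ((nodeState proc h v).clock + 1) ≠ 0
  received : ρ.received = reception ρ.reach ρ.sent
  ack : ∀ v m, m ∈ (ρ.output v).ack ↔
    ∃ b, loaded proc adv h v = some (m, b) ∧ P.acks b ((nodeState proc h v).clock + 1)
  rcv : ∀ v m, m ∈ (ρ.output v).rcv ↔ ρ.received v = some m ∧
    m ∉ (nodeState proc h v).delivered ∧ ∀ b, loaded proc adv h v ≠ some (m, b)
  current : ∀ v m b, (nodeState proc (h ++ [ρ]) v).current = some (m, b) ↔
    loaded proc adv h v = some (m, b) ∧ ¬ P.acks b ((nodeState proc h v).clock + 1)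
  delivered : ∀ v, (nodeState proc (h ++ [ρ]) v).delivered =
    (nodeState proc h v).delivered ∪ (ρ.output v).rcv
  clock : ∀ v, (nodeState proc (h ++ [ρ]) v).clock = (nodeState proc h v).clock + 1

/-- This replaces the code of the automaton by the properties in `IsNext`; apart from the
transmission probabilities, nothing else about a round is used later. -/
theorem isNext_nextRound {h : History V (P.algorithm n M)}
    {x : (i : Fin n) → ProtocolState M × Option M}
    (hx : ∀ i, x i ∈
      ((P.process M).act (h.state i) (adv.env h (proc.symm i))).support) :
    IsNext proc adv h (nextRound proc adv h x) := by
  have hx' : ∀ v, x (proc v) ∈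
      ((P.process M).act (nodeState proc h v) (adv.env h v)).support := fun v => by
    have := hx (proc v)
    rwa [Equiv.symm_apply_apply] at this
  have hstate : ∀ v, nodeState proc (h ++ [nextRound proc adv h x]) v =
      ((P.process M).finish (x (proc v)).1
        (reception (adv.reach h x) (fun v => (x (proc v)).2) v)).1 := fun v => by
    unfold nodeState
    rw [History.state_append]
    simp only [nextRound]
    rw [Equiv.symm_apply_apply]
  have hout : ∀ v, (nextRound proc adv h x).output v =
      ((P.process M).finish (x (proc v)).1
        (reception (adv.reach h x) (fun v => (x (proc v)).2) v)).2 := fun v => rfl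
  have hrec : (nextRound proc adv h x).received =
    reception (adv.reach h x) (fun v => (x (proc v)).2) := rfl
  refine ⟨rfl, adv.le_reach h x, adv.reach_le h x, fun v m hm => (mem_support_act (hx' v)).2 m hm,
    rfl, fun v m => ?_, fun v m => ?_, fun v m b => ?_, fun v => ?_, fun v => ?_⟩
  · rw [hout, (mem_support_act (hx' v)).1]
    rfl
  · rw [hout, hrec, (mem_support_act (hx' v)).1]
    rfl
  · rw [hstate, (mem_support_act (hx' v)).1]
    simp only [Protocol.process]
    rcases loaded proc adv h v with _ | ⟨m', b'⟩
    · simp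
    · by_cases hb : P.acks b' ((nodeState proc h v).clock + 1)
      · have : {m | ∃ b, some (m', b') = some (m, b) ∧
            P.acks b ((nodeState proc h v).clock + 1)}.Nonempty := ⟨m', b', rfl, hb⟩
        rw [if_pos this]
        simp only [reduceCtorEq, Option.some.injEq, Prod.mk.injEq, false_iff, not_and, not_not]
        rintro ⟨-, rfl⟩
        exact hb
      · have : ¬ {m | ∃ b, some (m', b') = some (m, b) ∧
            P.acks b ((nodeState proc h v).clock + 1)}.Nonempty := by
          rintro ⟨_, b, h1, h2⟩
          cases h1
          exact hb h2
        rw [if_neg this]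
        simp only [Option.some.injEq, Prod.mk.injEq, iff_self_and]
        rintro ⟨-, rfl⟩
        exact hb
  · rw [hstate, hout, (mem_support_act (hx' v)).1]
    rfl
  · rw [hstate, (mem_support_act (hx' v)).1]
    rfl

theorem exists_isNext {h y : History V (P.algorithm n M)}
    (hy : y ∈ (step proc adv h).support) : ∃ ρ, y = h ++ [ρ] ∧ IsNext proc adv h ρ := by
  obtain ⟨x, hx, rfl⟩ := mem_support_step hy
  exact ⟨_, rfl, isNext_nextRound hx⟩

end Execution

/-! ### Process states in terms of bcast, ack and rcv events -/

section Invariant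

variable {n : ℕ} {M V : Type} {P : Protocol} {net : DualGraph V} {proc : V ≃ Fin n}
  {adv : Adversary net (P.algorithm n M)}

/-- The relation between the states of the processes and the events of an execution. -/
structure Invariant (net : DualGraph V) (proc : V ≃ Fin n) (h : History V (P.algorithm n M)) :
    Prop where
  clock : ∀ v, (nodeState proc h v).clock = h.length
  current : ∀ v m b, (nodeState proc h v).current = some (m, b) ↔
    h.Bcast v m b ∧ ∀ s, ¬ h.Ack v m s
  delivered : ∀ v m, m ∈ (nodeState proc h v).delivered ↔ ∃ s, h.Rcv v m s
  bcast_unique : ∀ u v m r s, h.Bcast u m r → h.Bcast v m s → u = v ∧ r = s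
  ack_sound : ∀ v m s, h.Ack v m s → ∃ b ≤ s, h.Bcast v m b ∧ P.acks b s
  ack_unique : ∀ v m r s, h.Ack v m r → h.Ack v m s → r = s
  ack_of_acks : ∀ v m b t, h.Bcast v m b → b ≤ t → t ≤ h.length → P.acks b t →
    ∃ s ≤ t, h.Ack v m s
  ack_of_ack : ∀ v m m' r s, h.Ack v m r → h.Bcast v m' s → s ≤ r → ∃ s', h.Ack v m' s'
  rcv_sound : ∀ v m r, h.Rcv v m r →
    ∃ u, net.G'.Adj v u ∧ (∃ s < r, h.Bcast u m s) ∧ ∀ s < r, ¬ h.Ack u m s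
  rcv_unique : ∀ v m r s, h.Rcv v m r → h.Rcv v m s → r = s

theorem nodeState_nil (v : V) :
    nodeState proc ([] : History V (P.algorithm n M)) v = ⟨0, none, ∅⟩ := rfl

theorem Invariant.nil : Invariant net proc ([] : History V (P.algorithm n M)) where
  clock _ := rfl
  current _ _ _ := iff_of_false (by rw [nodeState_nil]; simp)
    fun h => History.not_bcast_nil h.1
  delivered _ _ := iff_of_false (by rw [nodeState_nil]; simp)
    fun ⟨_, h⟩ => History.not_rcv_nil h
  bcast_unique _ _ _ _ _ h := (History.not_bcast_nil h).elim
  ack_sound _ _ _ h := (History.not_ack_nil h).elim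
  ack_unique _ _ _ _ h := (History.not_ack_nil h).elim
  ack_of_acks _ _ _ _ h := (History.not_bcast_nil h).elim
  ack_of_ack _ _ _ _ _ h := (History.not_ack_nil h).elim
  rcv_sound _ _ _ h := (History.not_rcv_nil h).elim
  rcv_unique _ _ _ _ h := (History.not_rcv_nil h).elim

/-- A new input never overwrites an unacknowledged message. By well-formedness an input follows an
`ack` that comes after all earlier inputs of the process, and `ack_of_ack` says that such an `ack`
leaves no earlier message pending. -/
theorem Invariant.loaded_iff {h : History V (P.algorithm n M)} (hI : Invariant net proc h)
    (hW : WellFormed proc adv) (hh : Reachable proc adv h) {v : V} {m : M} {b : ℕ} :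
    loaded proc adv h v = some (m, b) ↔ (adv.env h v = some m ∧ b = h.length + 1) ∨
      (h.Bcast v m b ∧ ∀ s, ¬ h.Ack v m s) := by
  rw [← hI.current]
  unfold loaded
  rw [hI.clock]
  cases he : adv.env h v with
  | none => simp
  | some m' =>
    have hn : (nodeState proc h v).current ≠ some (m, b) := by
      rw [Ne, hI.current]
      rintro ⟨h1, h2⟩
      rcases hW.alternate h hh v m' he with h3 | ⟨m₀, r₀, h3, h4⟩
      · exact h3 _ _ h1
      · obtain ⟨s, hs⟩ := hI.ack_of_ack v m₀ m r₀ b h3 h1 (h4 _ _ h1)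
        exact h2 s hs
    simp only [Option.some.injEq, Prod.mk.injEq, hn, or_false]
    exact and_congr_right fun _ => eq_comm

/-- By `hP` a message is not transmitted in its arrival round, so its input lies strictly before the
current round, as the soundness of `rcv` demands. -/
theorem Invariant.bcast_of_sent {h : History V (P.algorithm n M)} (hI : Invariant net proc h)
    (hW : WellFormed proc adv) (hh : Reachable proc adv h)
    (hP : ∀ b t, P.prob b t ≠ 0 → b < t) {ρ : Round V (P.algorithm n M)}
    (hρ : IsNext proc adv h ρ) {v : V} {m : M} (hm : ρ.sent v = some m) :
    ∃ b, loaded proc adv h v = some (m, b) ∧ h.Bcast v m b ∧ ∀ s, ¬ h.Ack v m s := by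
  obtain ⟨b, h1, h2⟩ := hρ.sent v m hm
  refine ⟨b, h1, ?_⟩
  rcases (hI.loaded_iff hW hh).1 h1 with ⟨h3, rfl⟩ | h3
  · have := hP _ _ h2
    rw [hI.clock] at this
    omega
  · exact h3

theorem Invariant.append {h : History V (P.algorithm n M)} (hI : Invariant net proc h)
    (hW : WellFormed proc adv) (hh : Reachable proc adv h)
    (hP : ∀ b t, P.prob b t ≠ 0 → b < t) {ρ : Round V (P.algorithm n M)}
    (hρ : IsNext proc adv h ρ) : Invariant net proc (h ++ [ρ]) := by
  have hl := fun v m b => hI.loaded_iff hW hh (v := v) (m := m) (b := b)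
  have hb : ∀ v m r, History.Bcast (h ++ [ρ]) v m r ↔
      h.Bcast v m r ∨ (r = h.length + 1 ∧ adv.env h v = some m) := fun v m r => by
    rw [History.bcast_append, hρ.input]
  have ha : ∀ v m r, History.Ack (h ++ [ρ]) v m r ↔
      h.Ack v m r ∨ (r = h.length + 1 ∧
        ∃ b, loaded proc adv h v = some (m, b) ∧ P.acks b (h.length + 1)) := fun v m r => by
    rw [History.ack_append, hρ.ack, hI.clock]
  have hr : ∀ v m r, History.Rcv (h ++ [ρ]) v m r ↔
      h.Rcv v m r ∨ (r = h.length + 1 ∧ m ∈ (ρ.output v).rcv) := fun v m r =>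
    History.rcv_append
  have hfa : ∀ u v m, adv.env h u = some m → ∀ s, ¬ h.Ack v m s := fun u v m he s hs => by
    obtain ⟨b, -, h1, -⟩ := hI.ack_sound v m s hs
    exact hW.fresh h hh u m he v b h1
  have hna : ∀ v m b, loaded proc adv h v = some (m, b) → ∀ s, ¬ h.Ack v m s := fun v m b h1 => by
    rcases (hl v m b).1 h1 with ⟨h2, -⟩ | ⟨-, h2⟩
    · exact hfa v v m h2
    · exact h2
  have hlb : ∀ v m b, loaded proc adv h v = some (m, b) → b ≤ h.length + 1 ∧
      History.Bcast (h ++ [ρ]) v m b := fun v m b h1 => by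
    rw [hb]
    rcases (hl v m b).1 h1 with ⟨h2, h3⟩ | ⟨h2, -⟩
    · exact ⟨h3.le, Or.inr ⟨h3, h2⟩⟩
    · exact ⟨h2.le_length.2.trans (Nat.le_succ _), Or.inl h2⟩
  have hbu : ∀ u v m r s, History.Bcast (h ++ [ρ]) u m r → History.Bcast (h ++ [ρ]) v m s →
      u = v ∧ r = s := by
    intro u v m r s h1 h2
    rw [hb] at h1 h2
    rcases h1 with h1 | ⟨rfl, h1⟩ <;> rcases h2 with h2 | ⟨rfl, h2⟩
    · exact hI.bcast_unique u v m r s h1 h2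
    · exact (hW.fresh h hh v m h2 _ _ h1).elim
    · exact (hW.fresh h hh u m h1 _ _ h2).elim
    · exact ⟨hW.distinct h hh u v m h1 h2, rfl⟩
  have hbl : ∀ v m b, History.Bcast (h ++ [ρ]) v m b → (∀ s, ¬ h.Ack v m s) →
      loaded proc adv h v = some (m, b) := by
    intro v m b h1 h2
    rw [hl]
    rcases (hb v m b).1 h1 with h3 | ⟨h3, h4⟩
    · exact Or.inr ⟨h3, h2⟩
    · exact Or.inl ⟨h4, h3⟩
  refine ⟨fun v => ?_, fun v m b => ?_, fun v m => ?_, hbu, fun v m s h1 => ?_,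
    fun v m r s h1 h2 => ?_, fun v m b t h1 h2 h3 h4 => ?_, fun v m m' r s h1 h2 h3 => ?_,
    fun v m r h1 => ?_, fun v m r s h1 h2 => ?_⟩
  · rw [hρ.clock, hI.clock]
    simp
  · rw [hρ.current, hI.clock]
    constructor
    · rintro ⟨h1, h2⟩
      refine ⟨(hlb v m b h1).2, fun s hs => ?_⟩
      rcases (ha v m s).1 hs with h3 | ⟨-, b', h3, h4⟩
      · exact hna v m b h1 s h3
      · rw [h1] at h3
        cases h3
        exact h2 h4
    · rintro ⟨h1, h2⟩
      have h3 := hbl v m b h1 fun s hs => h2 s ((ha v m s).2 (Or.inl hs))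
      exact ⟨h3, fun h4 => h2 _ ((ha v m _).2 (Or.inr ⟨rfl, b, h3, h4⟩))⟩
  · rw [hρ.delivered, Set.mem_union, hI.delivered]
    simp only [hr, exists_or, exists_eq_left]
  · rcases (ha v m s).1 h1 with h2 | ⟨rfl, b, h2, h3⟩
    · obtain ⟨b, h3, h4, h5⟩ := hI.ack_sound v m s h2
      exact ⟨b, h3, (hb _ _ _).2 (Or.inl h4), h5⟩
    · exact ⟨b, (hlb v m b h2).1, (hlb v m b h2).2, h3⟩
  · rcases (ha v m r).1 h1 with h3 | ⟨rfl, b, h3, -⟩ <;>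
      rcases (ha v m s).1 h2 with h4 | ⟨rfl, b', h4, -⟩
    · exact hI.ack_unique v m r s h3 h4
    · exact (hna v m b' h4 r h3).elim
    · exact (hna v m b h3 s h4).elim
    · rfl
  · by_cases h5 : ∃ s ≤ t, h.Ack v m s
    · obtain ⟨s, h5, h6⟩ := h5
      exact ⟨s, h5, (ha _ _ _).2 (Or.inl h6)⟩
    · have h6 : t = h.length + 1 := by
        by_contra hne
        have h7 : t ≤ h.length := by
          simp at h3
          omega
        rcases (hb v m b).1 h1 with h8 | ⟨h8, -⟩
        · exact h5 (hI.ack_of_acks v m b t h8 h2 h7 h4)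
        · omega
      subst h6
      refine ⟨_, le_rfl, (ha _ _ _).2 (Or.inr ⟨rfl, b, hbl v m b h1 fun s hs => h5 ⟨s, ?_, hs⟩,
        h4⟩)⟩
      exact hs.le_length.2.trans (Nat.le_succ _)
  · by_contra h4
    push Not at h4
    have h5 : ∀ s', ¬ h.Ack v m' s' := fun s' hs => h4 s' ((ha _ _ _).2 (Or.inl hs))
    have h6 := hbl v m' s h2 h5
    rcases (ha v m r).1 h1 with h7 | ⟨rfl, b, h7, h8⟩
    · rcases (hb v m' s).1 h2 with h9 | ⟨h9, -⟩
      · obtain ⟨s', hs'⟩ := hI.ack_of_ack v m m' r s h7 h9 h3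
        exact h5 s' hs'
      · have := h7.le_length
        omega
    · rw [h6] at h7
      cases h7
      exact h4 _ ((ha _ _ _).2 (Or.inr ⟨rfl, s, h6, h8⟩))
  · rcases (hr v m r).1 h1 with h2 | ⟨rfl, h2⟩
    · obtain ⟨u, h3, ⟨s, h4, h5⟩, h6⟩ := hI.rcv_sound v m r h2
      refine ⟨u, h3, ⟨s, h4, (hb _ _ _).2 (Or.inl h5)⟩, fun s' hs' h7 => ?_⟩
      rcases (ha u m s').1 h7 with h8 | ⟨rfl, -⟩
      · exact h6 s' hs' h8
      · have := h2.le_length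
        omega
    · rw [hρ.rcv, hρ.received] at h2
      obtain ⟨h3, h4, h5⟩ := h2
      by_cases hv : ρ.sent v = none
      · obtain ⟨u, hu, hm⟩ := reception_eq_some hv h3
        obtain ⟨b, -, h6, h7⟩ := hI.bcast_of_sent hW hh hP hρ hm
        refine ⟨u, hρ.reach_le hu, ⟨b, ?_, (hb _ _ _).2 (Or.inl h6)⟩, fun s' hs' h8 => ?_⟩
        · have := h6.le_length
          omega
        · rcases (ha u m s').1 h8 with h9 | ⟨rfl, -⟩
          · exact h7 s' h9
          · omega
      -- A transmitting node hears only its own packet, and a process does not output its own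
      -- message by `rcv`.
      · rw [reception_of_sent hv] at h3
        obtain ⟨b, h6, -⟩ := hI.bcast_of_sent hW hh hP hρ h3
        exact (h5 b h6).elim
  · have key : ∀ r, h.Rcv v m r → m ∉ (ρ.output v).rcv := fun r h3 h4 =>
      ((hρ.rcv v m).1 h4).2.1 ((hI.delivered v m).2 ⟨r, h3⟩)
    rcases (hr v m r).1 h1 with h3 | ⟨rfl, h3⟩ <;> rcases (hr v m s).1 h2 with h4 | ⟨rfl, h4⟩
    · exact hI.rcv_unique v m r s h3 h4
    · exact (key r h3 h4).elim
    · exact (key s h4 h3).elim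
    · rfl

theorem Reachable.invariant (hW : WellFormed proc adv) (hP : ∀ b t, P.prob b t ≠ 0 → b < t)
    {h : History V (P.algorithm n M)} (hh : Reachable proc adv h) : Invariant net proc h := by
  refine Reachable.rec_step Invariant.nil (fun h y hh ih hy => ?_) hh
  obtain ⟨ρ, rfl, hρ⟩ := exists_isNext hy
  exact ih.append hW hh hP hρ

/-- In terms of the execution, `v` works in the round `t + 1` of `h` on the message with which it is
then active. -/
theorem loaded_take_iff (hW : WellFormed proc adv) (hP : ∀ b t, P.prob b t ≠ 0 → b < t)
    {h : History V (P.algorithm n M)} (hh : Reachable proc adv h) {t : ℕ} (ht : t < h.length)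
    {v : V} {m : M} {b : ℕ} :
    loaded proc adv (h.take t) v = some (m, b) ↔
      b ≤ t + 1 ∧ h.Bcast v m b ∧ ∀ s ≤ t, ¬ h.Ack v m s := by
  obtain ⟨ρ, h1, hρ⟩ := exists_isNext (hh.take_succ ht)
  have hlen : (h.take t).length = t := by simp [ht.le]
  rw [((hh.take t).invariant hW hP).loaded_iff hW (hh.take t), hlen]
  have h2 : History.Bcast (h.take (t + 1)) v m b ↔
      History.Bcast (h.take t) v m b ∨ (b = t + 1 ∧ adv.env (h.take t) v = some m) := by
    rw [h1, History.bcast_append, hρ.input, hlen]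
  rw [History.bcast_take] at h2
  have h3 : ∀ s, ¬ History.Ack (h.take t) v m s ↔ (s ≤ t → ¬ h.Ack v m s) := fun s => by
    rw [History.ack_take, not_and]
  simp_rw [h3]
  constructor
  · rintro (⟨h4, h5⟩ | ⟨h4, h5⟩)
    · have h6 := h2.2 (Or.inr ⟨h5, h4⟩)
      refine ⟨h6.1, h6.2, fun s hs h7 => ?_⟩
      obtain ⟨b', h8, h9, -⟩ := (hh.invariant hW hP).ack_sound v m s h7
      have := ((hh.invariant hW hP).bcast_unique _ _ _ _ _ h6.2 h9).2
      omega
    · have h6 := h2.2 (Or.inl h4)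
      exact ⟨h6.1, h6.2, h5⟩
  · rintro ⟨h4, h5, h6⟩
    rcases h2.1 ⟨h4, h5⟩ with h7 | ⟨h7, h8⟩
    · exact Or.inr ⟨h7, h6⟩
    · exact Or.inl ⟨h8, h7⟩

theorem activeWith_iff_loaded (hW : WellFormed proc adv) (hP : ∀ b t, P.prob b t ≠ 0 → b < t)
    {h : History V (P.algorithm n M)} (hh : Reachable proc adv h) {t : ℕ} (ht : t < h.length)
    {v : V} {m : M} :
    h.ActiveWith v m (t + 1) ↔ ∃ b, loaded proc adv (h.take t) v = some (m, b) := by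
  simp only [loaded_take_iff hW hP hh ht, History.ActiveWith, Nat.lt_succ_iff]
  constructor
  · rintro ⟨⟨b, h1, h2⟩, h3⟩
    exact ⟨b, h1, h2, h3⟩
  · rintro ⟨b, h1, h2, h3⟩
    exact ⟨⟨b, h1, h2⟩, h3⟩

end Invariant

/-! ### Phases and epochs -/

section Phases

variable {c : ℝ} {N : ℕ}

theorem phaseLength_pos (c : ℝ) (N i : ℕ) : 0 < phaseLength c N i := Nat.succ_pos _

theorem epochLength_zero (c : ℝ) (N : ℕ) : epochLength c N 0 = 0 := by
  simp [epochLength]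

theorem epochLength_succ (c : ℝ) (N k : ℕ) :
    epochLength c N (k + 1) = epochLength c N k + phaseLength c N (k + 1) := by
  rw [epochLength, epochLength, Finset.sum_Icc_succ_top (by omega)]

theorem epochLength_strictMono (c : ℝ) (N : ℕ) : StrictMono (epochLength c N) :=
  strictMono_nat_of_lt_succ fun k => by
    rw [epochLength_succ]
    exact Nat.lt_add_of_pos_right (phaseLength_pos c N _)

theorem phaseAt_nonempty (c : ℝ) (N s : ℕ) : {i | s < epochLength c N i}.Nonempty :=
  ⟨s + 1, (epochLength_strictMono c N).le_apply⟩

theorem phaseAt_eq {s k : ℕ} (h1 : epochLength c N k ≤ s) (h2 : s < epochLength c N (k + 1)) :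
    phaseAt c N s = k + 1 := by
  refine le_antisymm (Nat.sInf_le h2) ?_
  have h3 : s < epochLength c N (phaseAt c N s) := Nat.sInf_mem (phaseAt_nonempty c N s)
  exact (epochLength_strictMono c N).lt_iff_lt.1 (h1.trans_lt h3)

theorem phaseProb_eq {s k : ℕ} (h1 : epochLength c N k ≤ s) (h2 : s < epochLength c N (k + 1)) :
    phaseProb c N s = 2⁻¹ ^ (k + 1) := by
  rw [phaseProb, phaseAt_eq h1 h2]

theorem phaseProb_antitone (c : ℝ) (N : ℕ) : Antitone (phaseProb c N) := by
  intro s t hst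
  refine pow_le_pow_of_le_one (by positivity) (inv_le_one_of_one_le₀ one_le_two) ?_
  refine Nat.sInf_le ?_
  exact hst.trans_lt (Nat.sInf_mem (phaseAt_nonempty c N t))

theorem le_phaseLength (c : ℝ) (N i : ℕ) : c * 2 ^ i * Real.log N ≤ phaseLength c N i := by
  rw [phaseLength]
  push_cast
  exact (Nat.lt_floor_add_one _).le

theorem phaseLength_le (hc : 0 ≤ c) (N i : ℕ) :
    (phaseLength c N i : ℝ) ≤ c * 2 ^ i * Real.log N + 1 := by
  rw [phaseLength]
  push_cast
  have : 0 ≤ c * 2 ^ i * Real.log N := mul_nonneg (by positivity) (Real.log_natCast_nonneg N)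
  linarith [Nat.floor_le this]

/-- The phase lengths form a geometric series up to rounding; `hN` lets the extra round of each
phase be absorbed. -/
theorem epochLength_le (hc : 0 ≤ c) (hN : 1 ≤ c * Real.log N) (k : ℕ) :
    (epochLength c N k : ℝ) ≤ 3 * 2 ^ k * (c * Real.log N) := by
  suffices h : (epochLength c N k : ℝ) ≤ (3 * 2 ^ k - 3) * (c * Real.log N) by
    refine h.trans ?_
    nlinarith
  induction k with
  | zero => simp [epochLength_zero]
  | succ k ih =>
    rw [epochLength_succ]
    push_cast
    have h1 := phaseLength_le hc N (k + 1)
    have h2 : (1 : ℝ) ≤ 2 ^ k := one_le_pow₀ one_le_two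
    have h3 : (1 : ℝ) ≤ 2 ^ k * (c * Real.log N) := one_le_mul_of_one_le_of_one_le h2 hN
    rw [pow_succ] at *
    nlinarith

/-- In each phase, length times probability is at most c log N + 1 ≤ 2c log N, independently of the
phase. -/
theorem sum_phaseProb_le (hc : 0 ≤ c) (hN : 1 ≤ c * Real.log N) (k : ℕ) :
    ∑ s ∈ Finset.range (epochLength c N k), (phaseProb c N s : ℝ) ≤ 2 * k * (c * Real.log N) := by
  induction k with
  | zero => simp [epochLength_zero]
  | succ k ih =>
    rw [epochLength_succ, Finset.sum_range_add]
    have h1 : ∀ s ∈ Finset.range (phaseLength c N (k + 1)),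
        (phaseProb c N (epochLength c N k + s) : ℝ) = 2⁻¹ ^ (k + 1) := by
      intro s hs
      rw [Finset.mem_range] at hs
      rw [phaseProb_eq (Nat.le_add_right _ _) (by rw [epochLength_succ]; omega)]
      push_cast
      rfl
    rw [Finset.sum_congr rfl h1, Finset.sum_const, Finset.card_range, nsmul_eq_mul]
    have h2 : (phaseLength c N (k + 1) : ℝ) * 2⁻¹ ^ (k + 1) ≤ c * Real.log N + 1 := by
      calc (phaseLength c N (k + 1) : ℝ) * 2⁻¹ ^ (k + 1) ≤
            (c * 2 ^ (k + 1) * Real.log N + 1) * 2⁻¹ ^ (k + 1) := by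
            gcongr
            exact phaseLength_le hc N (k + 1)
        _ = c * Real.log N + 2⁻¹ ^ (k + 1) := by
            rw [inv_pow]
            field_simp
        _ ≤ _ := by
            gcongr
            exact pow_le_one₀ (by norm_num) (by norm_num)
    push_cast
    linarith

/-- A decreasing profile that starts after time `b`, seen through a window of length `l`, weighs
most if the window begins with the profile. If it starts inside the window, the window sees an even
shorter initial segment. -/
theorem sum_window_le {f : ℕ → ℝ} (hf : Antitone f) (h0 : ∀ s, 0 ≤ f s) (b t₀ l : ℕ) :
    ∑ s ∈ Finset.range l, (if b < t₀ + s then f (t₀ + s - 1 - b) else 0) ≤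
      ∑ s ∈ Finset.range l, f s := by
  rcases lt_or_ge b t₀ with hb | hb
  · refine Finset.sum_le_sum fun s _ => ?_
    rw [if_pos (by omega)]
    exact hf (by omega)
  · obtain ⟨d, rfl⟩ := Nat.exists_eq_add_of_le hb
    rcases le_or_gt l (d + 1) with hl | hl
    · rw [Finset.sum_eq_zero]
      · exact Finset.sum_nonneg fun s _ => h0 s
      · intro s hs
        rw [Finset.mem_range] at hs
        rw [if_neg (by omega)]
    · obtain ⟨e, rfl⟩ := Nat.exists_eq_add_of_lt hl
      rw [show d + 1 + e + 1 = (d + 1) + (e + 1) by ring, Finset.sum_range_add,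
        Finset.sum_eq_zero, zero_add]
      · rw [add_comm (d + 1), Finset.sum_range_add (fun s => f s)]
        refine le_trans (Finset.sum_le_sum fun s _ => ?_) (le_add_of_nonneg_right
          (Finset.sum_nonneg fun s _ => h0 _))
        rw [if_pos (by omega), show t₀ + (d + 1 + s) - 1 - (t₀ + d) = s by omega]
      · intro s hs
        rw [Finset.mem_range] at hs
        rw [if_neg (by omega)]

/-- Bernoulli's inequality with exponent 2^(i−1) gives 1/2, and squaring gives the exponent 2^i. -/
theorem quarter_le_one_sub_pow {i K : ℕ} (hi : 1 ≤ i) (hK : K ≤ 2 ^ i) :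
    (1 / 4 : ℝ) ≤ (1 - 2⁻¹ ^ i) ^ K := by
  have h0 : (2⁻¹ : ℝ) ^ i ≤ 2⁻¹ := by
    calc (2⁻¹ : ℝ) ^ i ≤ 2⁻¹ ^ 1 := pow_le_pow_of_le_one (by norm_num) (by norm_num) hi
      _ = 2⁻¹ := pow_one _
  have h1 : (0 : ℝ) ≤ 2⁻¹ ^ i := by positivity
  obtain ⟨j, rfl⟩ := Nat.exists_eq_add_of_le' hi
  have h2 : (1 / 2 : ℝ) ≤ (1 - 2⁻¹ ^ (j + 1)) ^ (2 ^ j) := by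
    have := one_add_mul_le_pow (a := -(2⁻¹ : ℝ) ^ (j + 1)) (by linarith) (2 ^ j)
    refine le_trans (le_of_eq ?_) (this.trans_eq ?_)
    · push_cast
      rw [inv_pow, pow_succ]
      field_simp
      norm_num
    · rw [← sub_eq_add_neg]
  calc (1 / 4 : ℝ) = (1 / 2) ^ 2 := by norm_num
    _ ≤ ((1 - 2⁻¹ ^ (j + 1)) ^ (2 ^ j)) ^ 2 := by gcongr
    _ = (1 - 2⁻¹ ^ (j + 1)) ^ (2 ^ (j + 1)) := by rw [← pow_mul, ← pow_succ]
    _ ≤ _ := pow_le_pow_of_le_one (by linarith) (by linarith) hK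

/-- The Weierstrass product inequality, used where the rivals transmit with different probabilities.
-/
theorem one_sub_sum_le_prod {ι : Type} (S : Finset ι) (f : ι → ℝ) (h0 : ∀ i ∈ S, 0 ≤ f i)
    (h1 : ∀ i ∈ S, f i ≤ 1) : 1 - ∑ i ∈ S, f i ≤ ∏ i ∈ S, (1 - f i) := by
  classical
  induction S using Finset.induction_on with
  | empty => simp
  | insert a S ha ih =>
    rw [Finset.sum_insert ha, Finset.prod_insert ha]
    have h2 := ih (fun i hi => h0 i (Finset.mem_insert_of_mem hi))
      fun i hi => h1 i (Finset.mem_insert_of_mem hi)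
    have h3 := h0 a (Finset.mem_insert_self a S)
    have h4 := h1 a (Finset.mem_insert_self a S)
    have h5 : 0 ≤ ∑ i ∈ S, f i :=
      Finset.sum_nonneg fun i hi => h0 i (Finset.mem_insert_of_mem hi)
    nlinarith [mul_le_mul_of_nonneg_left h2 (sub_nonneg.2 h4), mul_nonneg h3 h5]

theorem logPhases_le (D : ℕ) (hD : 1 ≤ D) : D < 2 ^ logPhases D ∧ 2 ^ logPhases D ≤ 2 * D := by
  refine ⟨Nat.lt_pow_succ_log_self one_lt_two D, ?_⟩
  rw [logPhases, pow_succ]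
  have := Nat.pow_log_le_self 2 (x := D) (by omega)
  omega

/-- A phase in which the transmission probability of a process is below that of `k` processes that
are in arbitrary phases, on average. -/
theorem exists_phase (k : ℕ) (hk : 1 ≤ k) : ∃ i, logPhases k ≤ i ∧ 8 * k * i ≤ 2 ^ i ∧
    (2 : ℝ) ^ i ≤ 1536 * (k * Real.log (k + 1)) := by
  set l := logPhases k with hl
  have hl1 : 1 ≤ l := by simp [hl, logPhases]
  obtain ⟨h1, h2⟩ := logPhases_le k hk
  obtain ⟨h3, h4⟩ := logPhases_le l hl1
  have h5 : logPhases l ≤ l := by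
    rw [logPhases]
    exact Nat.log_lt_self 2 (by omega)
  -- The three summands make 2^i a product of about k, about log k and 2^7. The last factor covers 8
  -- · 9 = 72, where 9l bounds the index i itself.
  refine ⟨l + logPhases l + 7, by omega, ?_, ?_⟩
  · rw [pow_add, pow_add]
    calc 8 * k * (l + logPhases l + 7) ≤ 8 * k * (9 * l) := Nat.mul_le_mul_left _ (by omega)
      _ = k * l * 72 := by ring
      _ ≤ 2 ^ l * 2 ^ logPhases l * 2 ^ 7 := by
        gcongr
        norm_num
  · have h6 : (l : ℝ) * Real.log 2 ≤ 2 * Real.log (k + 1) := by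
      have h7 : (2 : ℝ) ^ l ≤ (k + 1 : ℝ) ^ 2 := by
        have h8 : ((2 ^ l : ℕ) : ℝ) ≤ ((2 * k : ℕ) : ℝ) := Nat.cast_le.2 h2
        push_cast at h8
        nlinarith [sq_nonneg (k : ℝ)]
      have := Real.log_le_log (by positivity) h7
      rw [Real.log_pow, Real.log_pow] at this
      exact_mod_cast this
    have h8 : (l : ℝ) ≤ 3 * Real.log (k + 1) := by
      have h9 : (l : ℝ) ≥ 0 := Nat.cast_nonneg l
      nlinarith [Real.log_two_gt_d9]
    have h10 : (2 : ℝ) ^ l ≤ 2 * k := by exact_mod_cast h2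
    have h11 : (2 : ℝ) ^ logPhases l ≤ 2 * l := by exact_mod_cast h4
    rw [pow_add, pow_add]
    calc (2 : ℝ) ^ l * 2 ^ logPhases l * 2 ^ 7 ≤ 2 * (k : ℝ) * (2 * (l : ℝ)) * 2 ^ 7 := by gcongr
      _ = 512 * (k : ℝ) * (l : ℝ) := by ring
      _ ≤ 512 * (k : ℝ) * (3 * Real.log (k + 1)) := by gcongr
      _ = _ := by ring

end Phases

/-! ### Rounds of the interleaved protocols -/

section Interleave

variable {cS cA : ℝ} {N D : ℕ}

theorem logPhases_pos (D : ℕ) : 1 ≤ logPhases D := Nat.succ_pos _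

theorem sapLength_pos (c : ℝ) (N D : ℕ) : 0 < sapLength c N D := by
  have := epochLength_strictMono c N (logPhases_pos D)
  rw [sapLength]
  omega

theorem sapEpochStart_eq {c : ℝ} {j s t : ℕ} (hs : s < sapLength c N D)
    (ht : t = j * sapLength c N D + s + 1) :
    sapEpochStart c N D t = j * sapLength c N D := by
  rw [sapEpochStart, ht, Nat.add_sub_cancel, mul_comm j, Nat.mul_add_div (sapLength_pos c N D),
    Nat.div_eq_of_lt hs, add_zero, mul_comm]

theorem sap_acks_iff {c : ℝ} {b t : ℕ} : (SAP c N D).acks b t ↔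
    ∃ j, t = (j + 1) * sapLength c N D ∧ b ≤ j * sapLength c N D := by
  change b ≤ sapEpochStart c N D t ∧ t = sapEpochStart c N D t + sapLength c N D ↔ _
  constructor
  · rintro ⟨h1, h2⟩
    refine ⟨(t - 1) / sapLength c N D, ?_, h1⟩
    rw [add_mul, one_mul]
    exact h2
  · rintro ⟨j, h1, h2⟩
    have hL := sapLength_pos c N D
    rw [sapEpochStart_eq (j := j) (s := sapLength c N D - 1) (by omega)
      (by rw [h1, add_mul, one_mul]; omega)]
    exact ⟨h2, by rw [h1, add_mul, one_mul]⟩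

/-- Round (j+1)L of SAP is the odd round 2(j+1)L − 1. A message is in time for epoch j if (b+1)/2 ≤
jL, that is b ≤ 2jL, so an arrival in the even round 2jL still counts. -/
theorem interleave_acks_iff {Q : Protocol} {b t : ℕ} :
    ((SAP cS N D).interleave Q).acks b t ↔
      ∃ j, t + 1 = 2 * (j + 1) * sapLength cS N D ∧ b ≤ 2 * j * sapLength cS N D := by
  change Odd t ∧ (SAP cS N D).acks ((b + 1) / 2) ((t + 1) / 2) ↔ _
  rw [sap_acks_iff]
  constructor
  · rintro ⟨⟨r, rfl⟩, j, h1, h2⟩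
    refine ⟨j, ?_, ?_⟩
    · rw [mul_assoc, ← h1]
      omega
    · rw [mul_assoc]
      omega
  · rintro ⟨j, h1, h2⟩
    rw [mul_assoc] at h1 h2
    have h3 : 0 < (j + 1) * sapLength cS N D := Nat.mul_pos (Nat.succ_pos j) (sapLength_pos cS N D)
    exact ⟨⟨(j + 1) * sapLength cS N D - 1, by omega⟩, j, by omega, by omega⟩

theorem interleave_prob_odd {Q : Protocol} {b j s : ℕ} (hs : s < sapLength cS N D) :
    ((SAP cS N D).interleave Q).prob b (2 * (j * sapLength cS N D + s) + 1) =
      if b ≤ 2 * j * sapLength cS N D then phaseProb cS N s else 0 := by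
  change (if Odd (2 * (j * sapLength cS N D + s) + 1) then (SAP cS N D).prob ((b + 1) / 2)
    ((2 * (j * sapLength cS N D + s) + 1 + 1) / 2) else _) = _
  rw [if_pos ⟨_, rfl⟩, show (2 * (j * sapLength cS N D + s) + 1 + 1) / 2 =
    j * sapLength cS N D + s + 1 by omega]
  change (if (b + 1) / 2 ≤ sapEpochStart cS N D (j * sapLength cS N D + s + 1) then
    phaseProb cS N (j * sapLength cS N D + s + 1 - 1 -
      sapEpochStart cS N D (j * sapLength cS N D + s + 1)) else 0) = _
  rw [sapEpochStart_eq hs rfl, mul_assoc, show j * sapLength cS N D + s + 1 - 1 -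
    j * sapLength cS N D = s by omega]
  congr 1
  rw [eq_iff_iff]
  omega

theorem interleave_prob_even {P : Protocol} {b t : ℕ} :
    (P.interleave (APP cA N D)).prob b (2 * t) =
      if b / 2 < t ∧ t ≤ b / 2 + appLength cA N D then phaseProb cA N (t - 1 - b / 2) else 0 := by
  change (if Odd (2 * t) then _ else (APP cA N D).prob (b / 2) (2 * t / 2)) = _
  rw [if_neg (by simp), Nat.mul_div_cancel_left t two_pos]
  rfl

theorem interleave_prob_ne_zero {b t : ℕ}
    (h : ((SAP cS N D).interleave (APP cA N D)).prob b t ≠ 0) : b < t := by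
  rcases Nat.even_or_odd' t with ⟨s, rfl | rfl⟩
  · rw [interleave_prob_even] at h
    have h1 := (ne_eq _ _ ▸ ite_ne_right_iff.1 h).1.1
    omega
  · have hL := sapLength_pos cS N D
    have h1 : 2 * s + 1 = 2 * (s / sapLength cS N D * sapLength cS N D + s % sapLength cS N D) + 1 := by
      rw [Nat.div_add_mod']
    rw [h1, interleave_prob_odd (Nat.mod_lt _ hL)] at h
    have h2 := (ite_ne_right_iff.1 h).1
    rw [mul_assoc] at h2
    have h3 := Nat.div_mul_le_self s (sapLength cS N D)
    omega

end Interleave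

/-! ### The probability of a reception -/

section Hit

variable {n : ℕ} {M V : Type} [Fintype V] {P : Protocol} {net : DualGraph V} {proc : V ≃ Fin n}
  {adv : Adversary net (P.algorithm n M)}

open Classical in
/-- The nodes that have to be silent for a reception at `v` from `u`. -/
def rivals (net : DualGraph V) (u v : V) : Finset V :=
  Finset.univ.filter fun w => w ≠ u ∧ (w = v ∨ net.G'.Adj v w)

/-- Given the history the coins are independent, but the reach set depends on them. Silence of all
rivals in G', and of the receiver itself, makes the packet arrive under every admissible reach set,
so the product of the single probabilities is a lower bound. -/
theorem le_step_of_received {h : History V (P.algorithm n M)} {u v : V} {m : M} {b : ℕ}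
    (huv : net.G.Adj v u) (hu : loaded proc adv h u = some (m, b))
    {Succ : History V (P.algorithm n M) → Prop}
    (hS : ∀ ρ, IsNext proc adv h ρ → ρ.received v = some m → ρ.sent v = none → Succ (h ++ [ρ])) :
    (sendProb proc adv h u : ℝ) * ∏ w ∈ rivals net u v, (1 - (sendProb proc adv h w : ℝ)) ≤
      ((step proc adv h).toOuterMeasure {y | Succ y}).toReal := by
  classical
  have hur : u ∉ rivals net u v := by simp [rivals]
  -- The event is a box, so the product rule for independent draws applies; the remaining processes
  -- are unconstrained.
  let B : (i : Fin n) → Set (((P.algorithm n M) i).State × Option M) := fun i =>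
    if proc.symm i = u then {y | y.2 = some m}
    else if proc.symm i ∈ rivals net u v then {y | y.2 = none} else Set.univ
  let f : V → ℝ≥0 := fun w =>
    if w = u then sendProb proc adv h u
    else if w ∈ rivals net u v then 1 - sendProb proc adv h w else 1
  have h1 : (drawAll n fun i => ((P.algorithm n M) i).act (h.state i)
      (adv.env h (proc.symm i))).toOuterMeasure {x | ∀ i, x i ∈ B i} ≤
      (step proc adv h).toOuterMeasure {y | Succ y} := by
    rw [step, PMF.toOuterMeasure_map_apply]
    refine PMF.toOuterMeasure_mono _ ?_
    rintro x ⟨hx, hsupp⟩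
    have hnext := isNext_nextRound (adv := adv) (fun i => mem_support_of_mem_support_drawAll hsupp i)
    have hxu : (x (proc u)).2 = some m := by
      have := hx (proc u)
      simp only [B, Equiv.symm_apply_apply, if_true] at this
      exact this
    have hxw : ∀ w ∈ rivals net u v, (x (proc w)).2 = none := fun w hw => by
      have := hx (proc w)
      have hne : w ≠ u := fun h => hur (h ▸ hw)
      simp only [B, Equiv.symm_apply_apply, if_neg hne, if_pos hw] at this
      exact this
    have hv : (x (proc v)).2 = none :=
      hxw v (by simp only [rivals, Finset.mem_filter, Finset.mem_univ, true_or, and_true, true_and]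
                exact huv.ne)
    refine hS _ hnext ?_ hv
    rw [hnext.received]
    refine reception_of_unique hv (hnext.le_reach huv) hxu fun w hw1 hw2 => hxw w ?_
    simp only [rivals, Finset.mem_filter, Finset.mem_univ, true_and]
    exact ⟨hw1, Or.inr (hnext.reach_le hw2)⟩
  have h2 : ∀ i, (((P.algorithm n M) i).act (h.state i) (adv.env h (proc.symm i))).toOuterMeasure
      (B i) = (f (proc.symm i) : ℝ≥0∞) := by
    intro i
    obtain ⟨w, rfl⟩ := proc.surjective i
    simp only [B, f, Equiv.symm_apply_apply]
    by_cases hw : w = u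
    · subst hw
      rw [if_pos rfl, if_pos rfl]
      exact act_some h w hu
    · rw [if_neg hw, if_neg hw]
      by_cases hr : w ∈ rivals net u v
      · rw [if_pos hr, if_pos hr]
        exact act_none h w
      · rw [if_neg hr, if_neg hr, ENNReal.coe_one, PMF.toOuterMeasure_apply_eq_one_iff]
        exact Set.subset_univ _
  rw [toOuterMeasure_drawAll, Finset.prod_congr rfl fun i _ => h2 i,
    Equiv.prod_comp proc.symm fun w => (f w : ℝ≥0∞),
    ← ENNReal.ofNNReal_finsetProd] at h1
  have h3 : ∏ w, f w = sendProb proc adv h u * ∏ w ∈ rivals net u v, (1 - sendProb proc adv h w) := by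
    rw [← Finset.prod_subset (Finset.subset_univ (insert u (rivals net u v))),
      Finset.prod_insert hur]
    · congr 1
      · simp [f]
      · refine Finset.prod_congr rfl fun w hw => ?_
        have hne : w ≠ u := fun h => hur (h ▸ hw)
        simp only [f, if_neg hne, if_pos hw]
    · intro w _ hw
      rw [Finset.mem_insert, not_or] at hw
      simp only [f, if_neg hw.1, if_neg hw.2]
  rw [h3] at h1
  have h4 := ENNReal.toReal_mono (ne_top_of_le_ne_top ENNReal.one_ne_top
    (toOuterMeasure_le_one _ _)) h1
  rw [ENNReal.coe_toReal] at h4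
  refine le_trans (le_of_eq ?_) h4
  push_cast
  congr 1
  refine Finset.prod_congr rfl fun w _ => ?_
  rw [NNReal.coe_sub (sendProb_le_one h w), NNReal.coe_one]

end Hit

/-! ### Epochs of the interleaving of SAP and APP -/

/-- The interleaving of SAP and APP with the same constant. -/
abbrev sapAppProtocol (c : ℝ) (N D : ℕ) : Protocol := (SAP c N D).interleave (APP c N D)

section Epoch

variable {c : ℝ} {N D n : ℕ} {M V : Type} {net : DualGraph V} {proc : V ≃ Fin n}
  {adv : Adversary net ((sapAppProtocol c N D).algorithm n M)}
  {x : History V ((sapAppProtocol c N D).algorithm n M)}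

/-- Acknowledgments fall on the last rounds of blocks only, so the set of working processes cannot
shrink earlier in a block. -/
theorem not_ack_of_mem_epoch (hW : WellFormed proc adv) (hx : Reachable proc adv x) {j s : ℕ}
    (h1 : 2 * j * sapLength c N D ≤ s) (h2 : s + 1 < 2 * (j + 1) * sapLength c N D) (v : V)
    (m : M) : ¬ x.Ack v m s := by
  intro h
  obtain ⟨b, -, -, h3⟩ := (hx.invariant hW fun b t => interleave_prob_ne_zero).ack_sound v m s h
  obtain ⟨i, h4, -⟩ := interleave_acks_iff.1 h3
  rw [h4] at h2
  have h5 := lt_of_mul_lt_mul_right h2 (Nat.zero_le _)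
  have h6 : 2 * j * sapLength c N D < 2 * (i + 1) * sapLength c N D := by omega
  have h7 := lt_of_mul_lt_mul_right h6 (Nat.zero_le _)
  omega

theorem loaded_of_loaded (hW : WellFormed proc adv) (hx : Reachable proc adv x) {j t R : ℕ}
    (htR : t ≤ R) (hR : R < x.length) (h1 : 2 * j * sapLength c N D ≤ t + 1)
    (h2 : R + 2 ≤ 2 * (j + 1) * sapLength c N D) {v : V} {m : M} {b : ℕ}
    (hl : loaded proc adv (x.take t) v = some (m, b)) :
    loaded proc adv (x.take R) v = some (m, b) := by
  have hP : ∀ b t, (sapAppProtocol c N D).prob b t ≠ 0 → b < t :=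
    fun b t => interleave_prob_ne_zero
  rw [loaded_take_iff hW hP hx (by omega)] at hl ⊢
  refine ⟨by omega, hl.2.1, fun s hs => ?_⟩
  rcases le_or_gt s t with hst | hst
  · exact hl.2.2 s hst
  · exact not_ack_of_mem_epoch hW hx (j := j) (by omega) (by omega) v m

/-- A reception comes from a working neighbor, and it has been output at the end of the round. -/
theorem rcv_of_received {P : Protocol} {adv : Adversary net (P.algorithm n M)}
    (hW : WellFormed proc adv) (hP : ∀ b t, P.prob b t ≠ 0 → b < t)
    {h : History V (P.algorithm n M)} (hh : Reachable proc adv h)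
    {ρ : Round V (P.algorithm n M)} (hρ : IsNext proc adv h ρ) {u : V} {m : M}
    (hr : ρ.received u = some m) (hu : ρ.sent u = none) :
    (∃ s ≤ h.length + 1, History.Rcv (h ++ [ρ]) u m s) ∧
      ∃ w b, loaded proc adv h w = some (m, b) := by
  have hI := hh.invariant hW hP
  rw [hρ.received] at hr
  obtain ⟨w, -, hm⟩ := reception_eq_some hu hr
  obtain ⟨b, hb, h1, -⟩ := hI.bcast_of_sent hW hh hP hρ hm
  refine ⟨?_, w, b, hb⟩
  by_cases hd : m ∈ (nodeState proc h u).delivered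
  · obtain ⟨s, hs⟩ := (hI.delivered u m).1 hd
    exact ⟨s, hs.le_length.2.trans (Nat.le_succ _), History.rcv_append.2 (Or.inl hs)⟩
  · refine ⟨_, le_rfl, History.rcv_append.2 (Or.inr ⟨rfl, ?_⟩)⟩
    rw [hρ.rcv, hρ.received]
    refine ⟨hr, hd, fun b' hb' => ?_⟩
    rcases (hI.loaded_iff hW hh).1 hb' with ⟨h2, -⟩ | ⟨h2, -⟩
    · exact hW.fresh h hh u m h2 w b h1
    · obtain ⟨rfl, -⟩ := hI.bcast_unique _ _ _ _ _ h1 h2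
      rw [hu] at hm
      cases hm

theorem sendProb_of_loaded {P : Protocol} {adv : Adversary net (P.algorithm n M)}
    (hW : WellFormed proc adv) (hP : ∀ b t, P.prob b t ≠ 0 → b < t)
    {x : History V (P.algorithm n M)} (hx : Reachable proc adv x) {t : ℕ} (ht : t ≤ x.length)
    {v : V} {m : M} {b : ℕ} (hl : loaded proc adv (x.take t) v = some (m, b)) :
    sendProb proc adv (x.take t) v = P.prob b (t + 1) := by
  unfold sendProb
  rw [hl, ((hx.take t).invariant hW hP).clock]
  simp [ht]

theorem sendProb_of_not_loaded {P : Protocol} {adv : Adversary net (P.algorithm n M)}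
    {h : History V (P.algorithm n M)} {v : V} (hl : loaded proc adv h v = none) :
    sendProb proc adv h v = 0 := by
  unfold sendProb
  rw [hl]

variable [Fintype V]

-- The sender `v` is itself counted in the contention of `u` but is not a rival, while `u` is a
-- possible rival not counted in its own contention. Exchanging the two costs nothing.
open Classical in
theorem card_rivals_le {P : Protocol} {adv : Adversary net (P.algorithm n M)}
    (hW : WellFormed proc adv) (hP : ∀ b t, P.prob b t ≠ 0 → b < t)
    {x : History V (P.algorithm n M)} (hx : Reachable proc adv x) {t : ℕ} (ht : t < x.length)
    {u v : V} (huv : net.G.Adj u v) (hv : loaded proc adv (x.take t) v ≠ none) :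
    ((rivals net v u).filter fun w => loaded proc adv (x.take t) w ≠ none).card ≤
      contention net x u (t + 1) := by
  have hact : ∀ w, loaded proc adv (x.take t) w ≠ none → x.Active w (t + 1) := fun w hw => by
    obtain ⟨⟨m, b⟩, h1⟩ := Option.ne_none_iff_exists'.1 hw
    exact ⟨m, (activeWith_iff_loaded hW hP hx ht).2 ⟨b, h1⟩⟩
  unfold contention
  set S := Finset.univ.filter fun w => net.G'.Adj u w ∧ x.Active w (t + 1) with hS
  have hvS : v ∈ S := by
    rw [hS, Finset.mem_filter]
    exact ⟨Finset.mem_univ _, net.le huv, hact v hv⟩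
  calc _ ≤ (insert u (S.erase v)).card := by
        refine Finset.card_le_card fun w hw => ?_
        simp only [rivals, Finset.mem_filter, Finset.mem_univ, true_and] at hw
        rw [Finset.mem_insert, Finset.mem_erase, hS, Finset.mem_filter]
        rcases hw.1.2 with h1 | h1
        · exact Or.inl h1
        · exact Or.inr ⟨hw.1.1, Finset.mem_univ _, h1, hact w hw.2⟩
    _ ≤ (S.erase v).card + 1 := Finset.card_insert_le _ _
    _ = S.card := Finset.card_erase_add_one hvS

theorem contention_mono (hW : WellFormed proc adv) (hx : Reachable proc adv x) {j t R : ℕ}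
    (htR : t ≤ R) (hR : R < x.length) (h1 : 2 * j * sapLength c N D ≤ t + 1)
    (h2 : R + 2 ≤ 2 * (j + 1) * sapLength c N D) (u : V) :
    contention net x u (t + 1) ≤ contention net x u (R + 1) := by
  classical
  have hP : ∀ b t, (sapAppProtocol c N D).prob b t ≠ 0 → b < t :=
    fun b t => interleave_prob_ne_zero
  unfold contention
  refine Finset.card_le_card fun w hw => ?_
  rw [Finset.mem_filter] at hw ⊢
  obtain ⟨h3, h4, m, h5⟩ := hw
  obtain ⟨b, h6⟩ := (activeWith_iff_loaded hW hP hx (by omega)).1 h5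
  exact ⟨h3, h4, m, (activeWith_iff_loaded hW hP hx hR).2
    ⟨b, loaded_of_loaded hW hx htR hR h1 h2 h6⟩⟩

/-- The conditional probability of success in a round of SAP. -/
theorem le_step_sap (hW : WellFormed proc adv) (hx : Reachable proc adv x) {j k s : ℕ}
    (ht : 2 * (j * sapLength c N D + s) < x.length) (hs : s < sapLength c N D)
    (h1 : epochLength c N k ≤ s) (h2 : s < epochLength c N (k + 1)) {u v : V}
    (huv : net.G.Adj u v) {m : M} {b : ℕ}
    (hv : loaded proc adv (x.take (2 * (j * sapLength c N D + s))) v = some (m, b))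
    (hb : b ≤ 2 * j * sapLength c N D)
    (hK : contention net x u (2 * (j * sapLength c N D + s) + 1) ≤ 2 ^ (k + 1))
    {Succ : History V ((sapAppProtocol c N D).algorithm n M) → Prop}
    (hS : ∀ ρ, IsNext proc adv (x.take (2 * (j * sapLength c N D + s))) ρ →
      ρ.received u = some m → ρ.sent u = none →
      Succ (x.take (2 * (j * sapLength c N D + s)) ++ [ρ])) :
    2⁻¹ ^ (k + 1) * (1 / 4) ≤ ((step proc adv
      (x.take (2 * (j * sapLength c N D + s)))).toOuterMeasure {y | Succ y}).toReal := by
  classical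
  have hP : ∀ b t, (sapAppProtocol c N D).prob b t ≠ 0 → b < t :=
    fun b t => interleave_prob_ne_zero
  set t := 2 * (j * sapLength c N D + s) with htdef
  have hp : ∀ w m' b', loaded proc adv (x.take t) w = some (m', b') →
      sendProb proc adv (x.take t) w =
        if b' ≤ 2 * j * sapLength c N D then 2⁻¹ ^ (k + 1) else 0 := fun w m' b' hl => by
    rw [sendProb_of_loaded hW hP hx ht.le hl, htdef, interleave_prob_odd hs, phaseProb_eq h1 h2]
  -- Processes whose message came too late for the epoch are silent in SAP, so treating every
  -- working process as a ready one only lowers the bound.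
  have h3 : ∀ w, (1 - (sendProb proc adv (x.take t) w : ℝ)) ≥
      if loaded proc adv (x.take t) w ≠ none then 1 - 2⁻¹ ^ (k + 1) else 1 := fun w => by
    rcases hl : loaded proc adv (x.take t) w with _ | ⟨m', b'⟩
    · rw [sendProb_of_not_loaded hl]
      simp
    · rw [hp w m' b' hl]
      simp only [ne_eq, reduceCtorEq, not_false_eq_true, if_true]
      by_cases hb' : b' ≤ 2 * j * sapLength c N D
      · rw [if_pos hb']
        simp
      · rw [if_neg hb']
        simp
  have h4 : (2⁻¹ : ℝ) ^ (k + 1) ≤ 1 := pow_le_one₀ (by norm_num) (by norm_num)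
  have h5 : 0 ≤ (2⁻¹ : ℝ) ^ (k + 1) := by positivity
  refine le_trans ?_ (le_step_of_received huv hv hS)
  rw [hp v m b hv, if_pos hb]
  push_cast
  gcongr
  calc (1 / 4 : ℝ) ≤ (1 - 2⁻¹ ^ (k + 1)) ^
        ((rivals net v u).filter fun w => loaded proc adv (x.take t) w ≠ none).card :=
        quarter_le_one_sub_pow (Nat.succ_pos k)
          ((card_rivals_le hW hP hx ht huv (by simp [hv])).trans hK)
    _ = ∏ w ∈ rivals net v u,
        if loaded proc adv (x.take t) w ≠ none then (1 - 2⁻¹ ^ (k + 1) : ℝ) else 1 := by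
        rw [← Finset.prod_filter, Finset.prod_const]
    _ ≤ _ := by
        refine Finset.prod_le_prod (fun w _ => ?_) fun w _ => h3 w
        split_ifs <;> linarith

theorem sum_image_le {f : ℕ → ℝ} (h0 : ∀ t, 0 ≤ f t) {g : ℕ → ℕ} (hg : Function.Injective g)
    {l a e : ℕ} (h : ∀ s < l, a ≤ g s ∧ g s < e) :
    ∑ s ∈ Finset.range l, f (g s) ≤ ∑ t ∈ Finset.Ico a e, f t := by
  rw [← Finset.sum_image (f := f) hg.injOn]
  refine Finset.sum_le_sum_of_subset_of_nonneg ?_ fun t _ _ => h0 t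
  intro t ht
  obtain ⟨s, hs, rfl⟩ := Finset.mem_image.1 ht
  exact Finset.mem_Ico.2 (h s (Finset.mem_range.1 hs))

/-- The conditional probabilities of success in a phase of SAP. -/
theorem le_sum_sap (hW : WellFormed proc adv) (hx : Reachable proc adv x) {j k R : ℕ}
    (hR : R < x.length) (hjR : R + 2 ≤ 2 * (j + 1) * sapLength c N D)
    (hk : 2 * (j * sapLength c N D + epochLength c N (k + 1)) ≤ R + 2) {u v : V}
    (huv : net.G.Adj u v) {m : M} {b : ℕ}
    (hv : loaded proc adv (x.take R) v = some (m, b))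
    (hb : b ≤ 2 * j * sapLength c N D)
    (hK : contention net x u (R + 1) ≤ 2 ^ (k + 1))
    {Succ : History V ((sapAppProtocol c N D).algorithm n M) → Prop}
    (hS : ∀ t ≤ R, 2 * j * sapLength c N D ≤ t → ∀ ρ, IsNext proc adv (x.take t) ρ →
      ρ.received u = some m → ρ.sent u = none → Succ (x.take t ++ [ρ])) {a e : ℕ}
    (ha : a ≤ 2 * j * sapLength c N D) (he : R < e) :
    c * Real.log N / 4 ≤ ∑ t ∈ Finset.Ico a e,
      ((step proc adv (x.take t)).toOuterMeasure {y | Succ y}).toReal := by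
  have hP : ∀ b t, (sapAppProtocol c N D).prob b t ≠ 0 → b < t :=
    fun b t => interleave_prob_ne_zero
  have hE := epochLength_succ c N k
  have hd : 2 * (j + 1) * sapLength c N D =
    2 * (j * sapLength c N D) + 2 * sapLength c N D := by ring
  have hd' : 2 * j * sapLength c N D = 2 * (j * sapLength c N D) := by ring
  -- The history of length 2(jL + E + s), with E the length of the earlier phases, precedes the odd
  -- round that is round s of the phase. All other rounds are discarded.
  refine le_trans ?_ (sum_image_le (fun t => ENNReal.toReal_nonneg)
    (g := fun s => 2 * (j * sapLength c N D + (epochLength c N k + s)))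
    (l := phaseLength c N (k + 1)) (fun s s' h => by simpa using h) fun s hs => by
      constructor
      · rw [hd'] at ha
        omega
      · omega)
  calc c * Real.log N / 4 = (c * 2 ^ (k + 1) * Real.log N) * (2⁻¹ ^ (k + 1) * (1 / 4)) := by
        rw [inv_pow]
        field_simp
    _ ≤ phaseLength c N (k + 1) * (2⁻¹ ^ (k + 1) * (1 / 4)) := by
        gcongr
        exact le_phaseLength c N (k + 1)
    _ = ∑ s ∈ Finset.range (phaseLength c N (k + 1)), 2⁻¹ ^ (k + 1) * (1 / 4 : ℝ) := by
        simp
    _ ≤ _ := by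
        refine Finset.sum_le_sum fun s hs => ?_
        rw [Finset.mem_range] at hs
        have h1 : 2 * (j * sapLength c N D + (epochLength c N k + s)) ≤ R := by omega
        have h2 := (loaded_take_iff hW hP hx hR).1 hv
        refine le_step_sap hW hx (by omega) (by omega) (Nat.le_add_right _ _) (by omega) huv
          ((loaded_take_iff hW hP hx (by omega)).2 ⟨?_, h2.2.1, fun s' hs' => h2.2.2 s' ?_⟩) hb
          ((contention_mono hW hx h1 hR ?_ hjR u).trans hK) (hS _ h1 ?_)
        all_goals omega

/-- The conditional probabilities of success in a phase of APP. -/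
theorem le_sum_app (hW : WellFormed proc adv) (hx : Reachable proc adv x) (hc : 0 ≤ c)
    (hN : 1 ≤ c * Real.log N) {j k K R : ℕ}
    (hR : R < x.length) (hjR : R + 2 ≤ 2 * (j + 1) * sapLength c N D) {u v : V}
    (huv : net.G.Adj u v) {m : M} {b : ℕ}
    (hv : loaded proc adv (x.take R) v = some (m, b))
    (hb : 2 * j * sapLength c N D < b) (hk : b + 2 * epochLength c N (k + 1) ≤ R + 1)
    (hcK : contention net x u (R + 1) ≤ K) (hK : 8 * K * (k + 1) ≤ 2 ^ (k + 1))
    {Succ : History V ((sapAppProtocol c N D).algorithm n M) → Prop}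
    (hS : ∀ t ≤ R, 2 * j * sapLength c N D ≤ t → ∀ ρ, IsNext proc adv (x.take t) ρ →
      ρ.received u = some m → ρ.sent u = none → Succ (x.take t ++ [ρ])) {a e : ℕ}
    (ha : a ≤ 2 * j * sapLength c N D) (he : R < e) :
    c * Real.log N / 4 ≤ ∑ t ∈ Finset.Ico a e,
      ((step proc adv (x.take t)).toOuterMeasure {y | Succ y}).toReal := by
  classical
  have hP : ∀ b t, (sapAppProtocol c N D).prob b t ≠ 0 → b < t :=
    fun b t => interleave_prob_ne_zero
  have hE := epochLength_succ c N k
  have hd : 2 * (j + 1) * sapLength c N D =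
    2 * j * sapLength c N D + 2 * sapLength c N D := by ring
  -- All that is needed of the length of an APP epoch: the block ends before the epoch of a message
  -- that arrived in it.
  have happ : sapLength c N D ≤ appLength c N D :=
    (epochLength_strictMono c N).monotone (Nat.le_add_right _ _)
  set l := phaseLength c N (k + 1) with hl
  -- `t₀` is the first APP round of phase k+1 of the sender, and round `g s + 1` is the even round
  -- 2(t₀ + s).
  set t₀ := b / 2 + 1 + epochLength c N k with ht₀
  set g : ℕ → ℕ := fun s => 2 * (t₀ + s) - 1 with hg
  have hgs : ∀ s, g s + 1 = 2 * (t₀ + s) := fun s => by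
    simp only [hg]
    omega
  have hgR : ∀ s < l, g s ≤ R ∧ 2 * j * sapLength c N D ≤ g s := fun s hs => by
    simp only [hg]
    omega
  have hvs : ∀ s < l, loaded proc adv (x.take (g s)) v = some (m, b) := fun s hs => by
    have h1 := (loaded_take_iff hW hP hx hR).1 hv
    have h2 := hgR s hs
    have h3 := hgs s
    exact (loaded_take_iff hW hP hx (by omega)).2
      ⟨by omega, h1.2.1, fun s' hs' => h1.2.2 s' (by omega)⟩
  have hpv : ∀ s < l, (sendProb proc adv (x.take (g s)) v : ℝ) = 2⁻¹ ^ (k + 1) := fun s hs => by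
    have h2 := hgR s hs
    rw [sendProb_of_loaded hW hP hx (by omega) (hvs s hs), hgs, interleave_prob_even,
      if_pos (by omega), phaseProb_eq (k := k) (by omega) (by omega)]
    push_cast
    rfl
  -- No process acknowledges within this part of the block, so a rival works on a single message
  -- with one arrival round throughout the phase of the sender. Its epoch may have begun at any
  -- time, and `sum_window_le` compares it with one that begins together with the window.
  have hpw : ∀ w, ∑ s ∈ Finset.range l, (sendProb proc adv (x.take (g s)) w : ℝ) ≤
      if loaded proc adv (x.take R) w ≠ none then 2 * (k + 1) * (c * Real.log N) else 0 := by
    intro w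
    have hback : ∀ s < l, ∀ m' b', loaded proc adv (x.take (g s)) w = some (m', b') →
        loaded proc adv (x.take R) w = some (m', b') := fun s hs m' b' h => by
      have h2 := hgR s hs
      exact loaded_of_loaded hW hx h2.1 hR (by omega) hjR h
    rcases hw : loaded proc adv (x.take R) w with _ | ⟨m', b'⟩
    · simp only [ne_eq, not_true_eq_false, if_false]
      refine (Finset.sum_eq_zero fun s hs => ?_).le
      rcases h : loaded proc adv (x.take (g s)) w with _ | ⟨m', b'⟩
      · rw [sendProb_of_not_loaded h, NNReal.coe_zero]
      · rw [hback s (Finset.mem_range.1 hs) m' b' h] at hw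
        cases hw
    · rw [if_pos (by simp)]
      have hf : Antitone fun s => (phaseProb c N s : ℝ) := fun s s' h =>
        NNReal.coe_le_coe.2 (phaseProb_antitone c N h)
      calc _ ≤ ∑ s ∈ Finset.range l, (if b' / 2 < t₀ + s then
              (phaseProb c N (t₀ + s - 1 - b' / 2) : ℝ) else 0) := by
            refine Finset.sum_le_sum fun s hs => ?_
            rcases h : loaded proc adv (x.take (g s)) w with _ | ⟨m₁, b₁⟩
            · rw [sendProb_of_not_loaded h, NNReal.coe_zero]
              split_ifs
              · exact NNReal.coe_nonneg _
              · exact le_rfl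
            · have h3 := hback s (Finset.mem_range.1 hs) m₁ b₁ h
              rw [hw] at h3
              cases h3
              have h2 := hgR s (Finset.mem_range.1 hs)
              rw [sendProb_of_loaded hW hP hx (by omega) h, hgs, interleave_prob_even]
              by_cases h4 : b' / 2 < t₀ + s
              · rw [if_pos h4]
                split_ifs
                · exact le_rfl
                · exact NNReal.coe_nonneg _
              · rw [if_neg h4, if_neg fun h => h4 h.1, NNReal.coe_zero]
        _ ≤ ∑ s ∈ Finset.range l, (phaseProb c N s : ℝ) :=
            sum_window_le hf (fun s => NNReal.coe_nonneg _) (b' / 2) t₀ l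
        _ ≤ ∑ s ∈ Finset.range (epochLength c N (k + 1)), (phaseProb c N s : ℝ) := by
            refine Finset.sum_le_sum_of_subset_of_nonneg ?_ fun s _ _ => NNReal.coe_nonneg _
            rw [Finset.range_subset_range]
            omega
        _ ≤ _ := by
            have := sum_phaseProb_le hc hN (k + 1)
            push_cast at this
            exact this
  -- By `hK` the rivals' probabilities add up to at most a quarter of the lower bound for the phase
  -- length. This bounds them only on average; in single rounds their sum may be large.
  have hsum : ∑ s ∈ Finset.range l, ∑ w ∈ rivals net v u,
      (sendProb proc adv (x.take (g s)) w : ℝ) ≤ 2 ^ (k + 1) * (c * Real.log N) / 4 := by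
    rw [Finset.sum_comm]
    calc _ ≤ ∑ w ∈ rivals net v u,
          if loaded proc adv (x.take R) w ≠ none then 2 * ((k : ℝ) + 1) * (c * Real.log N) else 0 :=
          Finset.sum_le_sum fun w _ => hpw w
      _ = ((rivals net v u).filter fun w => loaded proc adv (x.take R) w ≠ none).card *
          (2 * ((k : ℝ) + 1) * (c * Real.log N)) := by
          rw [← Finset.sum_filter, Finset.sum_const, nsmul_eq_mul]
      _ ≤ (K : ℝ) * (2 * ((k : ℝ) + 1) * (c * Real.log N)) := by
          gcongr
          exact (card_rivals_le hW hP hx hR huv (by simp [hv])).trans hcK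
      _ = (8 * K * (k + 1) : ℕ) * (c * Real.log N) / 4 := by
          push_cast
          ring
      _ ≤ _ := by
          gcongr
          exact_mod_cast hK
  refine le_trans ?_ (sum_image_le (fun t => ENNReal.toReal_nonneg) (g := g) (l := l)
    (fun s s' h => by
      have h1 := hgs s
      have h2 := hgs s'
      rw [h] at h1
      omega) fun s hs => by
      have := hgR s hs
      omega)
  -- The exact value is 3/4 of c log N; it is weakened to match the bound for SAP.
  calc c * Real.log N / 4 ≤ 2⁻¹ ^ (k + 1) * ((c * 2 ^ (k + 1) * Real.log N) -
        2 ^ (k + 1) * (c * Real.log N) / 4) := by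
        have : (2⁻¹ : ℝ) ^ (k + 1) * ((c * 2 ^ (k + 1) * Real.log N) -
          2 ^ (k + 1) * (c * Real.log N) / 4) = 3 / 4 * (c * Real.log N) := by
          rw [inv_pow]
          field_simp
          ring
        rw [this]
        linarith
    _ ≤ 2⁻¹ ^ (k + 1) * (l - ∑ s ∈ Finset.range l, ∑ w ∈ rivals net v u,
          (sendProb proc adv (x.take (g s)) w : ℝ)) := by
        gcongr
        exact le_phaseLength c N (k + 1)
    _ = ∑ s ∈ Finset.range l, 2⁻¹ ^ (k + 1) * (1 - ∑ w ∈ rivals net v u,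
          (sendProb proc adv (x.take (g s)) w : ℝ)) := by
        rw [← Finset.mul_sum, Finset.sum_sub_distrib]
        simp
    _ ≤ _ := by
        refine Finset.sum_le_sum fun s hs => ?_
        rw [Finset.mem_range] at hs
        refine le_trans ?_ (le_step_of_received huv (hvs s hs)
          (hS _ (hgR s hs).1 (hgR s hs).2))
        rw [hpv s hs]
        gcongr
        exact one_sub_sum_le_prod _ _ (fun w _ => NNReal.coe_nonneg _)
          fun w _ => by exact_mod_cast sendProb_le_one _ w

end Epoch

/-! ### Acknowledgments -/

/-- The witness is b / (2L) rounded up: the first epoch for which a message arriving in round `b` is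
in time. -/
theorem exists_next_epoch (b : ℕ) {L : ℕ} (hL : 0 < L) :
    ∃ j, b ≤ 2 * j * L ∧ 2 * j * L < b + 2 * L := by
  refine ⟨(b + (2 * L - 1)) / (2 * L), ?_⟩
  have h1 := Nat.div_add_mod (b + (2 * L - 1)) (2 * L)
  have h2 := Nat.mod_lt (b + (2 * L - 1)) (show 2 * L > 0 by omega)
  have h3 : 2 * ((b + (2 * L - 1)) / (2 * L)) * L =
      2 * L * ((b + (2 * L - 1)) / (2 * L)) := by ring
  omega

theorem firstRounds_take {n : ℕ} {M W V : Type} {A : Algorithm n M W} (ω : ℕ → Round V A)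
    {T T' : ℕ} (h : T ≤ T') : (firstRounds ω T').take T = firstRounds ω T := by
  rw [firstRounds, firstRounds, ← List.map_take, List.take_range, min_eq_left h]

theorem length_firstRounds {n : ℕ} {M W V : Type} {A : Algorithm n M W} (ω : ℕ → Round V A)
    (T : ℕ) : (firstRounds ω T).length = T := by
  simp [firstRounds]

section Acknowledgment

variable {c : ℝ} {N D n : ℕ} {M V : Type} {net : DualGraph V} {proc : V ≃ Fin n}
  {adv : Adversary net ((sapAppProtocol c N D).algorithm n M)}
  {x : History V ((sapAppProtocol c N D).algorithm n M)}

theorem exists_ack (hW : WellFormed proc adv) (hx : Reachable proc adv x) {u : V} {m : M}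
    {b j : ℕ} (hb : x.Bcast u m b) (hj : b ≤ 2 * j * sapLength c N D)
    (hlen : 2 * (j + 1) * sapLength c N D ≤ x.length + 1) :
    ∃ s, s + 1 ≤ 2 * (j + 1) * sapLength c N D ∧ b ≤ s ∧ x.Ack u m s := by
  have hI := hx.invariant hW fun b t => interleave_prob_ne_zero
  have hL := sapLength_pos c N D
  have hd : 2 * (j + 1) * sapLength c N D =
    2 * j * sapLength c N D + 2 * sapLength c N D := by ring
  obtain ⟨s, h1, h2⟩ := hI.ack_of_acks u m b (2 * (j + 1) * sapLength c N D - 1) hb (by omega)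
    (by omega) (interleave_acks_iff.2 ⟨j, by omega, hj⟩)
  obtain ⟨b', h3, h4, -⟩ := hI.ack_sound u m s h2
  obtain ⟨-, rfl⟩ := hI.bcast_unique _ _ _ _ _ hb h4
  exact ⟨s, by omega, h3, h2⟩

/-- An acknowledgment ends some epoch i that the message was in time for, so i ≥ j by minimality of
j. If it has occurred, the history reaches the end of epoch j, where `exists_ack` supplies one, and
uniqueness identifies the two. -/
theorem ack_round (hW : WellFormed proc adv) (hx : Reachable proc adv x) {u : V} {m : M}
    {b j s : ℕ} (hb : x.Bcast u m b) (hj : b ≤ 2 * j * sapLength c N D)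
    (hj' : 2 * j * sapLength c N D < b + 2 * sapLength c N D) (hs : x.Ack u m s) :
    s + 1 = 2 * (j + 1) * sapLength c N D := by
  have hI := hx.invariant hW fun b t => interleave_prob_ne_zero
  obtain ⟨b', -, h2, h3⟩ := hI.ack_sound u m s hs
  obtain ⟨-, rfl⟩ := hI.bcast_unique _ _ _ _ _ hb h2
  obtain ⟨i, h4, h5⟩ := interleave_acks_iff.1 h3
  have hd : 2 * (i + 1) * sapLength c N D =
    2 * i * sapLength c N D + 2 * sapLength c N D := by ring
  have h6 : j ≤ i := by
    have h7 : 2 * j * sapLength c N D < 2 * (i + 1) * sapLength c N D := by omega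
    have h8 := lt_of_mul_lt_mul_right h7 (Nat.zero_le _)
    omega
  have h9 : 2 * (j + 1) * sapLength c N D ≤ 2 * (i + 1) * sapLength c N D := by gcongr
  have h10 := hs.le_length
  obtain ⟨s', h11, -, h12⟩ := exists_ack hW hx hb hj (by omega)
  have h13 := hI.ack_unique _ _ _ _ hs h12
  omega

theorem existsUnique_ack (hW : WellFormed proc adv)
    {ω : ℕ → Round V ((sapAppProtocol c N D).algorithm n M)} (hω : IsExecution proc adv ω) {u : V}
    {m : M} {r T : ℕ} (hb : (firstRounds ω T).Bcast u m r) :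
    ∃! r', r ≤ r' ∧ ∃ T, (firstRounds ω T).Ack u m r' := by
  obtain ⟨j, h1, -⟩ := exists_next_epoch r (sapLength_pos c N D)
  -- The prefix is extended until it contains the whole epoch; different prefixes are compared
  -- inside a common longer one.
  have hb' : (firstRounds ω (max T (2 * (j + 1) * sapLength c N D))).Bcast u m r := by
    rw [← firstRounds_take ω (le_max_left T (2 * (j + 1) * sapLength c N D))] at hb
    exact (History.bcast_take.1 hb).2
  obtain ⟨s, -, h2, h3⟩ := exists_ack hW (hω _) hb' h1 (by
    rw [length_firstRounds]
    exact (le_max_right _ _).trans (Nat.le_succ _))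
  refine ⟨s, ⟨h2, _, h3⟩, ?_⟩
  rintro s' ⟨-, T', h4⟩
  set T₁ := max T (2 * (j + 1) * sapLength c N D)
  rw [← firstRounds_take ω (le_max_left T' T₁)] at h4
  rw [← firstRounds_take ω (le_max_right T' T₁)] at h3
  exact ((hω (max T' T₁)).invariant hW fun b t => interleave_prob_ne_zero).ack_unique u m _ _
    (History.ack_take.1 h4).2 (History.ack_take.1 h3).2

theorem bcast_of_env {h : History V ((sapAppProtocol c N D).algorithm n M)}
    (hh : Reachable proc adv h) {u : V} {m : M} (hu : adv.env h u = some m) {T : ℕ}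
    (hx : x ∈ (run proc adv T h).support) (hT : h.length < x.length) :
    x.Bcast u m (h.length + 1) := by
  have h1 := (hh.run hx).take_succ hT
  rw [take_of_mem_support_run hx] at h1
  obtain ⟨ρ, h2, hρ⟩ := exists_isNext h1
  have h3 : History.Bcast (x.take (h.length + 1)) u m (h.length + 1) := by
    rw [h2, History.bcast_append, hρ.input]
    exact Or.inr ⟨rfl, hu⟩
  exact (History.bcast_take.1 h3).2

end Acknowledgment

/-! ### Receptions as success events -/

section Reception

variable {N D n : ℕ} {M V : Type} {net : DualGraph V} {proc : V ≃ Fin n}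
  {adv : Adversary net ((sapAppProtocol 8 N D).algorithm n M)}

/-- In the last round of `y`, the node `v` receives a packet that it has not sent. -/
def Receives (proc : V ≃ Fin n) (adv : Adversary net ((sapAppProtocol 8 N D).algorithm n M))
    (v : V) (p : M → Prop) (y : History V ((sapAppProtocol 8 N D).algorithm n M)) : Prop :=
  ∃ h ρ m, y = h ++ [ρ] ∧ IsNext proc adv h ρ ∧ ρ.received v = some m ∧ ρ.sent v = none ∧ p m

/-- The `rcv` output may be older than this reception, since a message is output only when it is
first received. -/
theorem Receives.rcv (hW : WellFormed proc adv)
    {x : History V ((sapAppProtocol 8 N D).algorithm n M)} (hx : Reachable proc adv x) {v : V}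
    {p : M → Prop} {t : ℕ} (ht : t < x.length) (h : Receives proc adv v p (x.take (t + 1))) :
    ∃ m, p m ∧ (∃ s ≤ t + 1, x.Rcv v m s) ∧
      ∃ w b, loaded proc adv (x.take t) w = some (m, b) := by
  obtain ⟨h', ρ, m, h1, hρ, h2, h3, hp⟩ := h
  have hlen : h'.length = t := by
    have := congrArg List.length h1
    simp at this
    omega
  have h4 : h' = x.take t := by
    have h5 : (x.take (t + 1)).take t = h' := by rw [h1, ← hlen, List.take_left]
    rw [← h5, List.take_take, min_eq_left (Nat.le_succ t)]
  subst h4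
  obtain ⟨⟨s, h6, h7⟩, h8⟩ := rcv_of_received hW (fun b t => interleave_prob_ne_zero)
    (hx.take t) hρ h2 h3
  rw [← h1] at h7
  exact ⟨m, hp, ⟨s, by omega, (History.rcv_take.1 h7).2⟩, h8⟩

end Reception

/-! ### Constants -/

section Constants

variable {a n N Δ D : ℕ} {b : ℝ}

theorem log_le_of_le_pow (hn : 2 ≤ n) (hnN : n ≤ N) (hN : N ≤ n ^ a) :
    Real.log n ≤ Real.log N ∧ Real.log N ≤ a * Real.log n ∧ 1 ≤ 8 * Real.log N := by
  have h0 : (0 : ℝ) < n := by positivity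
  have h1 : (n : ℝ) ≤ N := by exact_mod_cast hnN
  have h2 : (N : ℝ) ≤ (n : ℝ) ^ a := by exact_mod_cast hN
  refine ⟨Real.log_le_log h0 h1, ?_, ?_⟩
  · rw [← Real.log_pow]
    exact Real.log_le_log (h0.trans_le h1) h2
  · have h3 : (2 : ℝ) ≤ N := le_trans (by exact_mod_cast hn) h1
    have := Real.log_le_log two_pos h3
    linarith [Real.log_two_gt_d9]

theorem sapLength_le (hn : 2 ≤ n) (hnN : n ≤ N) (hN : N ≤ n ^ a) (hD : 1 ≤ D)
    (hDb : (D : ℝ) ≤ b * Δ) :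
    (sapLength 8 N D : ℝ) ≤ 48 * (a * |b|) * (Δ * Real.log n) := by
  obtain ⟨h1, h2, h3⟩ := log_le_of_le_pow hn hnN hN
  have h4 : (2 : ℝ) ^ logPhases D ≤ 2 * D := by exact_mod_cast (logPhases_le D hD).2
  have h5 : (D : ℝ) ≤ |b| * Δ := hDb.trans (by gcongr; exact le_abs_self b)
  calc (sapLength 8 N D : ℝ) ≤ 3 * 2 ^ logPhases D * (8 * Real.log N) :=
        epochLength_le (by norm_num) h3 _
    _ ≤ 3 * (2 * (|b| * Δ)) * (8 * (a * Real.log n)) := by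
        gcongr
        linarith
    _ = _ := by ring

end Constants

/-! ### Delivery and progress -/

section Main

variable {N D n : ℕ} {M V : Type} [Fintype V] {net : DualGraph V} {proc : V ≃ Fin n}
  {adv : Adversary net ((sapAppProtocol 8 N D).algorithm n M)}

theorem ofReal_exp_neg_log (hn : 2 ≤ n) :
    ENNReal.ofReal (Real.exp (-Real.log n)) = (n : ℝ≥0∞)⁻¹ := by
  have h0 : (0 : ℝ) < n := by positivity
  rw [Real.exp_neg, Real.exp_log h0, ENNReal.ofReal_inv_of_pos h0, ENNReal.ofReal_natCast]

/-- Union bound: at most n receivers, each failing with probability at most n⁻². -/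
theorem sum_le_inv (hn : 2 ≤ n) (hV : Fintype.card V = n) (S : Finset V) :
    ∑ _v ∈ S, ENNReal.ofReal (Real.exp (-(2 * Real.log n))) ≤ (n : ℝ≥0∞)⁻¹ := by
  have h0 : (n : ℝ≥0∞) ≠ 0 := by
    norm_cast
    omega
  rw [two_mul, neg_add, Real.exp_add, ENNReal.ofReal_mul (Real.exp_nonneg _),
    ofReal_exp_neg_log hn, Finset.sum_const, nsmul_eq_mul]
  calc (S.card : ℝ≥0∞) * ((n : ℝ≥0∞)⁻¹ * (n : ℝ≥0∞)⁻¹) ≤ n * ((n : ℝ≥0∞)⁻¹ * (n : ℝ≥0∞)⁻¹) := by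
        gcongr
        rw [← hV]
        exact Finset.card_le_univ S
    _ = (n : ℝ≥0∞)⁻¹ := by
        rw [← mul_assoc, ENNReal.mul_inv_cancel h0 (ENNReal.natCast_ne_top n), one_mul]

theorem whp_delivery {a Δ : ℕ} (hn : 2 ≤ n) (hnN : n ≤ N) (hN : N ≤ n ^ a) (hD : Δ ≤ D)
    (hW : WellFormed proc adv)
    (hΔ : ∀ h, Reachable proc adv h → ∀ u r, r ≤ h.length → contention net h u r ≤ Δ)
    {h : History V ((sapAppProtocol 8 N D).algorithm n M)} (hh : Reachable proc adv h) {u : V}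
    {m : M} (hu : adv.env h u = some m) (T : ℕ) :
    WHP n (run proc adv T h) {x | ∀ r', h.length + 1 ≤ r' → x.Ack u m r' →
      ∀ v, net.G.Adj u v → ∃ s, h.length + 1 ≤ s ∧ s ≤ r' ∧ x.Rcv v m s} := by
  obtain ⟨hl1, -, hl3⟩ := log_le_of_le_pow hn hnN hN
  have hP : ∀ b t, (sapAppProtocol 8 N D).prob b t ≠ 0 → b < t :=
    fun b t => interleave_prob_ne_zero
  obtain ⟨j, hj, hj'⟩ := exists_next_epoch (h.length + 1) (sapLength_pos 8 N D)
  -- The length condition confines success to rounds up to the acknowledgment round 2(j+1)L − 1,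
  -- which is known in advance.
  let Succ : V → History V ((sapAppProtocol 8 N D).algorithm n M) → Prop := fun v y =>
    y.length + 1 ≤ 2 * (j + 1) * sapLength 8 N D ∧ Receives proc adv v (· = m) y
  let B : V → Set (History V ((sapAppProtocol 8 N D).algorithm n M)) := fun v =>
    {x | (∀ t, h.length ≤ t → t < h.length + T → ¬ Succ v (x.take (t + 1))) ∧
      2 * Real.log n ≤ ∑ t ∈ Finset.Ico h.length (h.length + T),
        ((step proc adv (x.take t)).toOuterMeasure {y | Succ v y}).toReal}
  refine WHP.of_compl_le (B := ⋃ v ∈ (Finset.univ : Finset V), B v) (fun x hx hxS => ?_) ?_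
  · simp only [Set.mem_ofPred_eq, not_forall] at hxS
    obtain ⟨r', hr', hack, v, huv, hno⟩ := hxS
    have hxr := hh.run hx
    have hlen := length_of_mem_support_run hx
    have hack' := hack.le_length
    have hb : x.Bcast u m (h.length + 1) := bcast_of_env hh hu hx (by omega)
    have hR := ack_round hW hxr hb hj hj' hack
    simp only [Finset.mem_univ, Set.iUnion_true, Set.mem_iUnion]
    refine ⟨v, fun t ht1 ht2 hSucc => hno ?_, ?_⟩
    · obtain ⟨m', rfl, ⟨s, h1, h2⟩, -⟩ := hSucc.2.rcv hW hxr (by omega)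
      have h3 := hSucc.1
      rw [List.length_take, min_eq_left (by omega)] at h3
      refine ⟨s, ?_, by omega, h2⟩
      by_contra h4
      -- An output before the input is impossible: by soundness somebody would already have had `m`
      -- as input, and inputs are fresh.
      have h5 : History.Rcv (x.take h.length) v m' s := History.rcv_take.2 ⟨by omega, h2⟩
      rw [take_of_mem_support_run hx] at h5
      obtain ⟨w, -, ⟨s', -, h6⟩, -⟩ := (hh.invariant hW hP).rcv_sound v m' s h5
      exact hW.fresh h hh u m' hu w s' h6
    · have h1 : 2 * Real.log n ≤ 8 * Real.log N / 4 := by linarith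
      refine h1.trans ?_
      have hd : 2 * (j * sapLength 8 N D + sapLength 8 N D) =
        2 * (j + 1) * sapLength 8 N D := by ring
      -- The last phase of the epoch has number `logPhases D`, and 2 to this power exceeds D, hence
      -- the contention.
      refine le_sum_sap (k := Nat.log 2 D) (R := r' - 1) (v := u) (m := m) (b := h.length + 1) hW
        hxr (by omega) (by omega) ?_ huv.symm ?_ hj ?_ ?_ (by omega) (by omega)
      · change 2 * (j * sapLength 8 N D + sapLength 8 N D) ≤ _
        omega
      · rw [loaded_take_iff hW hP hxr (by omega)]
        refine ⟨by omega, hb, fun s hs h2 => ?_⟩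
        have := (hxr.invariant hW hP).ack_unique _ _ _ _ hack h2
        omega
      · exact (hΔ x hxr v _ (by omega)).trans
          (hD.trans (Nat.lt_pow_succ_log_self one_lt_two D).le)
      · intro t ht1 ht2 ρ hρ h2 h3
        refine ⟨?_, x.take t, ρ, m, rfl, hρ, h2, h3, rfl⟩
        simp only [List.length_append, List.length_take, List.length_singleton]
        omega
  · refine (MeasureTheory.measure_biUnion_finset_le _ _).trans ?_
    refine (Finset.sum_le_sum fun v _ => run_failure_le (Succ v) T h _).trans ?_
    exact sum_le_inv hn (by simpa using Fintype.card_congr proc) _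

/-- If the window leaves the block of r, it contains the whole next block or crosses just one block
boundary. In the latter case the longer of the two parts has about half the length. -/
theorem exists_piece {L r r' : ℕ} (hL : 0 < L) (hr : r ≤ r') :
    ∃ j r₁ r₂, r ≤ r₁ ∧ r₁ ≤ r₂ ∧ r₂ ≤ r' ∧ 2 * j * L ≤ r₁ ∧ r₂ + 1 ≤ 2 * (j + 1) * L ∧
      ((r₁ = 2 * j * L ∧ r₂ + 1 = 2 * (j + 1) * L) ∨
        (r' < r + 4 * L ∧ r' + r₁ * 2 ≤ r + r₂ * 2 + 1)) := by
  have h1 := Nat.div_add_mod r (2 * L)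
  have h2 := Nat.mod_lt r (show 2 * L > 0 by omega)
  set i := r / (2 * L)
  have h3 : 2 * L * i = 2 * i * L := by ring
  have h4 : 2 * (i + 1) * L = 2 * i * L + 2 * L := by ring
  have h5 : 2 * (i + 1 + 1) * L = 2 * i * L + 4 * L := by ring
  rcases lt_or_ge r' (2 * (i + 1) * L) with h6 | h6
  · exact ⟨i, r, r', le_rfl, hr, le_rfl, by omega, by omega, Or.inr ⟨by omega, by omega⟩⟩
  · by_cases h7 : 2 * (i + 1 + 1) * L ≤ r' + 1
    · exact ⟨i + 1, 2 * (i + 1) * L, 2 * (i + 1 + 1) * L - 1, by omega, by omega, by omega,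
        le_rfl, by omega, Or.inl ⟨rfl, by omega⟩⟩
    · rcases le_total (2 * (i + 1) * L + 2 * (i + 1) * L) (r + r' + 1) with h8 | h8
      · exact ⟨i + 1, 2 * (i + 1) * L, r', by omega, h6, le_rfl, le_rfl, by omega,
          Or.inr ⟨by omega, by omega⟩⟩
      · exact ⟨i, r, 2 * (i + 1) * L - 1, le_rfl, by omega, by omega, by omega, by omega,
          Or.inr ⟨by omega, by omega⟩⟩

/-- The constant in the acknowledgment bound and in the progress bound. -/
def boundConstant (a : ℕ) (b : ℝ) : ℝ := 200000 * (a + 1) * (|b| + 1)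

theorem boundConstant_pos (a : ℕ) (b : ℝ) : 0 < boundConstant a b := by
  unfold boundConstant
  positivity

theorem four_mul_sapLength_le {a Δ : ℕ} {b : ℝ} (hn : 2 ≤ n) (hnN : n ≤ N) (hN : N ≤ n ^ a)
    (hD : 1 ≤ D) (hDb : (D : ℝ) ≤ b * Δ) :
    4 * (sapLength 8 N D : ℝ) ≤ boundConstant a b * (Δ * Real.log n) := by
  have h1 := sapLength_le hn hnN hN hD hDb
  have h2 : 4 * (48 * (a * |b|)) ≤ boundConstant a b := by
    unfold boundConstant
    have := abs_nonneg b
    have h3 : (0 : ℝ) ≤ a := Nat.cast_nonneg a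
    nlinarith [mul_nonneg h3 this]
  have h4 : 0 ≤ (Δ : ℝ) * Real.log n := mul_nonneg (Nat.cast_nonneg _) (Real.log_natCast_nonneg n)
  nlinarith [mul_le_mul_of_nonneg_right h2 h4]

theorem exists_phase_of_progress {a Δ : ℕ} {b : ℝ} (hn : 2 ≤ n) (hnN : n ≤ N) (hN : N ≤ n ^ a)
    (hD : 1 ≤ D) (hDb : (D : ℝ) ≤ b * Δ) {k r r' : ℕ} (hk : 1 ≤ k)
    (hr : r' < r + 4 * sapLength 8 N D)
    (hf : boundConstant a b * min (k * Real.log (k + 1) * Real.log n) (Δ * Real.log n) <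
      (r' : ℝ) - (r : ℝ)) :
    ∃ i, logPhases k ≤ i ∧ 8 * k * i ≤ 2 ^ i ∧ r + 4 * epochLength 8 N i + 1 ≤ r' := by
  obtain ⟨i, h1, h2, h3⟩ := exists_phase k hk
  refine ⟨i, h1, h2, ?_⟩
  obtain ⟨-, hl2, hl3⟩ := log_le_of_le_pow hn hnN hN
  have hC := boundConstant_pos a b
  -- The window is shorter than the second term of the minimum allows, so the first term is the one
  -- that was exceeded.
  have h4 : (r' : ℝ) - r < boundConstant a b * (Δ * Real.log n) := by
    have h5 : (r' : ℝ) < r + 4 * sapLength 8 N D := by exact_mod_cast hr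
    linarith [four_mul_sapLength_le hn hnN hN hD hDb]
  have h5 : boundConstant a b * (k * Real.log (k + 1) * Real.log n) < (r' : ℝ) - r := by
    rcases min_choice (k * Real.log (k + 1) * Real.log n) (Δ * Real.log n) with h6 | h6
    · rwa [h6] at hf
    · rw [h6] at hf
      linarith
  have hX : 0 ≤ (k : ℝ) * Real.log (k + 1) :=
    mul_nonneg (Nat.cast_nonneg _) (Real.log_nonneg (by linarith [Nat.cast_nonneg (α := ℝ) k]))
  have hln : 0 ≤ Real.log n := Real.log_natCast_nonneg n
  have h6 : (epochLength 8 N i : ℝ) ≤ 36864 * a * (k * Real.log (k + 1) * Real.log n) := by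
    calc (epochLength 8 N i : ℝ) ≤ 3 * 2 ^ i * (8 * Real.log N) :=
          epochLength_le (by norm_num) hl3 i
      _ ≤ 3 * (1536 * (k * Real.log (k + 1))) * (8 * (a * Real.log n)) := by
          gcongr
      _ = _ := by ring
  -- Four epoch lengths are wanted, because the piece is half of the window and APP owns every
  -- second round; the fifth pays for the additional round.
  have h7 : 5 * (36864 * (a : ℝ)) ≤ boundConstant a b := by
    unfold boundConstant
    have h8 := abs_nonneg b
    have h9 : (0 : ℝ) ≤ a := Nat.cast_nonneg a
    nlinarith [mul_nonneg h9 h8]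
  have h8 : 1 ≤ epochLength 8 N i := by
    have h9 : 0 < i := (logPhases_pos k).trans h1
    have := epochLength_strictMono 8 N h9
    omega
  have h9 : (r : ℝ) + 5 * epochLength 8 N i < r' := by
    nlinarith [mul_le_mul_of_nonneg_right h7 (mul_nonneg hX hln)]
  have h10 : r + 5 * epochLength 8 N i < r' := by exact_mod_cast h9
  omega

theorem whp_progress {a Δ : ℕ} {b : ℝ} (hn : 2 ≤ n) (hnN : n ≤ N) (hN : N ≤ n ^ a)
    (hD1 : 1 ≤ D) (hD : Δ ≤ D) (hDb : (D : ℝ) ≤ b * Δ) (hW : WellFormed proc adv)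
    (hΔ : ∀ h, Reachable proc adv h → ∀ u r, r ≤ h.length → contention net h u r ≤ Δ)
    {r r' : ℕ} (u : V) (hr1 : 1 ≤ r) (hr : r ≤ r') :
    WHP n (run proc adv r' []) {x |
      boundConstant a b * min (maxContention net x u r r' *
        Real.log (maxContention net x u r r' + 1) * Real.log n) (Δ * Real.log n) <
        (r' : ℝ) - (r : ℝ) →
      (∃ v, net.G.Adj u v ∧ ∀ s, r ≤ s → s ≤ r' → x.Active v s) →
      ∃ m, (∃ s ≤ r', x.Rcv u m s) ∧ ∃ w s, r ≤ s ∧ s ≤ r' ∧ x.ActiveWith w m s} := by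
  obtain ⟨hl1, -, hl3⟩ := log_le_of_le_pow hn hnN hN
  have hP : ∀ b t, (sapAppProtocol 8 N D).prob b t ≠ 0 → b < t :=
    fun b t => interleave_prob_ne_zero
  obtain ⟨j, r₁, r₂, h1, h2, h3, h4, h5, h6⟩ := exists_piece (sapLength_pos 8 N D) hr
  have hd : 2 * (j * sapLength 8 N D + sapLength 8 N D) =
    2 * (j + 1) * sapLength 8 N D := by ring
  have hd' : 2 * (j * sapLength 8 N D) = 2 * j * sapLength 8 N D := by ring
  -- Sender, message and phase will be read off the execution, so every reception by `u` in the
  -- block has to count as a success. The block and `r₂` depend only on r and r'.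
  let Succ : History V ((sapAppProtocol 8 N D).algorithm n M) → Prop := fun y =>
    2 * j * sapLength 8 N D < y.length ∧ y.length ≤ r₂ ∧ Receives proc adv u (fun _ => True) y
  refine WHP.of_compl_le (fun x hx hxS => ?_)
    ((run_failure_le Succ r' [] (Real.log n)).trans_eq (ofReal_exp_neg_log hn))
  have hxr := Reachable.nil.run hx
  have hlen : x.length = r' := by simpa using length_of_mem_support_run hx
  obtain ⟨R, rfl⟩ : ∃ R, r₂ = R + 1 := ⟨r₂ - 1, by omega⟩
  simp only [Set.mem_ofPred_eq, Classical.not_imp] at hxS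
  obtain ⟨hf, ⟨v, huv, hact⟩, hno⟩ := hxS
  refine ⟨fun t _ ht2 hSucc => hno ?_, ?_⟩
  · have ht : t < r' := by simpa using ht2
    obtain ⟨s1, s2, s3⟩ := hSucc
    obtain ⟨m, -, ⟨s, h7, h8⟩, w, b, h9⟩ := s3.rcv hW hxr (by omega)
    rw [List.length_take, min_eq_left (by omega)] at s1 s2
    refine ⟨m, ⟨s, by omega, h8⟩, w, R + 1, by omega, h3, ?_⟩
    -- The reception may precede r, but it lies in the same block, so the message is still active in
    -- round `r₂`, which belongs to the window.
    exact (activeWith_iff_loaded hW hP hxr (by omega)).2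
      ⟨b, loaded_of_loaded hW hxr (j := j) (by omega) (by omega) (by omega) h5 h9⟩
  · have h7 : Real.log n ≤ 8 * Real.log N / 4 := by
      linarith [Real.log_natCast_nonneg n]
    refine h7.trans ?_
    obtain ⟨q, rfl⟩ : ∃ q, r₁ = q + 1 := ⟨r₁ - 1, by omega⟩
    obtain ⟨m, hm⟩ := hact (q + 1) h1 (by omega)
    obtain ⟨b, hq⟩ := (activeWith_iff_loaded hW hP hxr (by omega)).1 hm
    have hbq := ((loaded_take_iff hW hP hxr (by omega)).1 hq).1
    have hv : loaded proc adv (x.take R) v = some (m, b) :=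
      loaded_of_loaded hW hxr (j := j) (by omega) (by omega) h4 h5 hq
    have hS : ∀ t ≤ R, 2 * j * sapLength 8 N D ≤ t → ∀ ρ, IsNext proc adv (x.take t) ρ →
        ρ.received u = some m → ρ.sent u = none → Succ (x.take t ++ [ρ]) := by
      intro t ht1 ht2 ρ hρ hρ1 hρ2
      have hl : (x.take t ++ [ρ]).length = t + 1 := by
        simp only [List.length_append, List.length_take, List.length_singleton]
        omega
      exact ⟨by omega, by omega, x.take t, ρ, m, rfl, hρ, hρ1, hρ2, trivial⟩
    have hsap : ∀ k, logPhases k = Nat.log 2 k + 1 := fun k => rfl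
    rcases h6 with ⟨h8, h9⟩ | ⟨h8, h9⟩
    -- The neighbor is active in round 2jL, hence in time for the full SAP epoch j.
    · refine le_sum_sap (k := Nat.log 2 D) hW hxr (by omega) h5 ?_ huv hv (by omega) ?_ hS
        (Nat.zero_le _) (by simp; omega)
      · change 2 * (j * sapLength 8 N D + sapLength 8 N D) ≤ _
        omega
      · exact (hΔ x hxr u _ (by omega)).trans
          (hD.trans (Nat.lt_pow_succ_log_self one_lt_two D).le)
    · have hcK : contention net x u (R + 1) ≤ maxContention net x u r r' :=
        Finset.le_sup (f := fun s => contention net x u s) (Finset.mem_Icc.2 ⟨by omega, h3⟩)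
      have hk1 : 1 ≤ maxContention net x u r r' := by
        refine le_trans ?_ hcK
        classical
        unfold contention
        refine Finset.card_pos.2 ⟨v, ?_⟩
        rw [Finset.mem_filter]
        exact ⟨Finset.mem_univ _, net.le huv, hact (R + 1) (by omega) h3⟩
      obtain ⟨i, hi1, hi2, hi3⟩ := exists_phase_of_progress hn hnN hN hD1 hDb hk1 h8 hf
      -- A message older than the block takes part in SAP, whose phase `logPhases` of the contention
      -- comes early enough. A message that arrived in the block takes part in APP since its
      -- arrival, and 2 `epochLength 8 N i` rounds of the piece complete phase i.
      rcases le_or_gt b (2 * j * sapLength 8 N D) with hb | hb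
      · have hE := (epochLength_strictMono 8 N).monotone hi1
        rw [hsap] at hE
        refine le_sum_sap (k := Nat.log 2 (maxContention net x u r r')) hW hxr (by omega) h5
          (by omega) huv hv hb (hcK.trans (Nat.lt_pow_succ_log_self one_lt_two _).le) hS
          (Nat.zero_le _) (by simp; omega)
      · obtain ⟨k, rfl⟩ := Nat.exists_eq_add_of_le' ((logPhases_pos _).trans hi1)
        exact le_sum_app hW hxr (by norm_num) hl3 (by omega) h5 huv hv hb (by omega) hcK hi2 hS
          (Nat.zero_le _) (by simp; omega)

theorem solvesLocalBroadcast {a Δ : ℕ} (hn : 1 ≤ n) (hnN : n ≤ N) (hN : N ≤ n ^ a) (hD : Δ ≤ D)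
    (hW : WellFormed proc adv)
    (hΔ : ∀ h, Reachable proc adv h → ∀ u r, r ≤ h.length → contention net h u r ≤ Δ) :
    SolvesLocalBroadcast proc adv where
  ack_exists ω hω u m r := fun ⟨_, hT⟩ => existsUnique_ack hW hω hT
  ack_only h hh u m r' hr' := by
    obtain ⟨b, h1, h2, -⟩ :=
      (hh.invariant hW fun b t => interleave_prob_ne_zero).ack_sound u m r' hr'
    exact ⟨b, h1, h2⟩
  rcv_unique h hh := (hh.invariant hW fun b t => interleave_prob_ne_zero).rcv_unique
  rcv_sound h hh := (hh.invariant hW fun b t => interleave_prob_ne_zero).rcv_sound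
  delivery h hh u m hu T := by
    rcases hn.eq_or_lt with rfl | hn
    · exact WHP.one _ _
    · exact whp_delivery hn hnN hN hD hW hΔ hh hu T

theorem hasAckBound {a Δ : ℕ} {b : ℝ} (hn : 1 ≤ n) (hnN : n ≤ N) (hN : N ≤ n ^ a) (hD : 1 ≤ D)
    (hDb : (D : ℝ) ≤ b * Δ) (hW : WellFormed proc adv) :
    HasAckBound proc adv fun _ => boundConstant a b * (Δ * Real.log n) := by
  intro h hh v m hv T
  rcases hn.eq_or_lt with rfl | hn
  · exact WHP.one _ _
  refine WHP.of_forall fun x hx r' hr' hack => ?_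
  obtain ⟨j, hj, hj'⟩ := exists_next_epoch (h.length + 1) (sapLength_pos 8 N D)
  have hb := bcast_of_env hh hv hx (by have := hack.le_length; omega)
  have h1 := ack_round hW (hh.run hx) hb hj hj' hack
  have h2 : 2 * (j + 1) * sapLength 8 N D =
    2 * j * sapLength 8 N D + 2 * sapLength 8 N D := by ring
  have h3 : r' ≤ h.length + 1 + 4 * sapLength 8 N D := by omega
  have h4 : (r' : ℝ) ≤ (h.length + 1 : ℕ) + 4 * sapLength 8 N D := by exact_mod_cast h3
  linarith [four_mul_sapLength_le (b := b) hn hnN hN hD hDb]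

theorem hasProgressBound {a Δ : ℕ} {b : ℝ} (hn : 1 ≤ n) (hnN : n ≤ N) (hN : N ≤ n ^ a)
    (hD1 : 1 ≤ D) (hD : Δ ≤ D) (hDb : (D : ℝ) ≤ b * Δ) (hW : WellFormed proc adv)
    (hΔ : ∀ h, Reachable proc adv h → ∀ u r, r ≤ h.length → contention net h u r ≤ Δ) :
    HasProgressBound proc adv fun k =>
      boundConstant a b * min (k * Real.log (k + 1) * Real.log n) (Δ * Real.log n) := by
  intro r r' u hr1 hr
  rcases hn.eq_or_lt with rfl | hn
  · exact WHP.one _ _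
  · exact whp_progress hn hnN hN hD1 hD hDb hW hΔ u hr1 hr

end Main

end LocalBroadcast

end

open LocalBroadcast

theorem mainTheorem4 (a : ℕ) (b : ℝ) :
    ∃ cS cA C : ℝ, 0 < cS ∧ 0 < cA ∧ 0 < C ∧
      ∀ (n N Δ D : ℕ), 1 ≤ n → n ≤ N → N ≤ n ^ a →
        1 ≤ Δ → Δ ≤ n → Δ ≤ D → (D : ℝ) ≤ b * Δ →
      ∀ (M V : Type) [Fintype V] (net : DualGraph V) (proc : V ≃ Fin n)
        (adv : Adversary net (sapApp cS cA N D n M)),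
        WellFormed proc adv →
        (∀ h, Reachable proc adv h → ∀ u r, r ≤ h.length → contention net h u r ≤ Δ) →
        SolvesLocalBroadcast proc adv ∧
        HasAckBound proc adv (fun _ => C * (Δ * Real.log n)) ∧
        HasProgressBound proc adv
          (fun k => C * min (k * Real.log (k + 1) * Real.log n) (Δ * Real.log n)) := by
  -- A good phase contributes c log N / 4, and c = 8 makes this 2 log N, as the union bound in the
  -- delivery proof requires.
  refine ⟨8, 8, boundConstant a b, by norm_num, by norm_num, boundConstant_pos a b, ?_⟩
  intro n N Δ D hn hnN hN hΔ1 _ hD hDb M V _ net proc adv hW hΔ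
  exact ⟨solvesLocalBroadcast hn hnN hN hD hW hΔ,
    hasAckBound hn hnN hN (hΔ1.trans hD) hDb hW,
    hasProgressBound hn hnN hN (hΔ1.trans hD) hD hDb hW hΔ⟩
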